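/- **Ising models.** Let $G=(V,E)$ be a finite simple graph with $n=|V|\ge 1$ and $m=|E|$. An Ising model $(G,J,h)$ consists of a symmetric matrix $J\in\mathbb R^{V\times V}$ with $J_{uv}\ne 0$ only if $\{u,v\}\in E$, and a vector $h\in\mathbb R^V$. For $\sigma\in\{-1,+1\}^V$ put $w(\sigma)=\exp(\tfrac12\sigma^{T}J\sigma+h^{T}\sigma)$. The partition function is $Z=\sum_\sigma w(\sigma)$ and the Gibbs distribution is $w(\sigma)/Z$. A Gibbs distribution $\mu$ is *$b$-marginally bounded* if for all $\Lambda\subseteq V$, $\tau\in\{-1,+1\}^\Lambda$, $v\in V\setminus\Lambda$ and $c\in\{-1,+1\}$, the conditional probability under $\mu$ that $\sigma_v=c$, given $\sigma|_\Lambda=\tau$, is at least $b$. For two Ising models $(G,J^\nu,h^\nu)$, $(G,J^\mu,h^\mu)$ with Gibbs distributions $\nu,\mu$ and an integer $\alpha\ge1$, let $$D_{\chi^\alpha}(\nu\,\|\,\mu)=\frac12\sum_{\sigma}\mu(\sigma)\left|\frac{\nu(\sigma)}{\mu(\sigma)}-1\right|^\alpha,$$ and let $\mathcal F(\nu,\mu,\alpha)$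 be the family of the Ising models $(G,J^{(k)},h^{(k)})$, $0\le k\le\alpha$, where $J^{(k)}=kJ^\nu-(k-1)J^\mu$ and $h^{(k)}=kh^\nu-(k-1)h^\mu$. **Oracles.** Let $T^{\mathrm{sp}}_G,T^{\mathrm{ct}}_G:\mathbb R_{>0}\to[n+m,\infty)$ be non-increasing. A *sampling oracle* with cost $T^{\mathrm{sp}}_G$ for an Ising model with Gibbs distribution $\pi$ takes $\delta>0$ and returns, in time $T^{\mathrm{sp}}_G(\delta)$, a random $X\in\{-1,+1\}^V$ whose law is within total variation distance $\delta$ of $\pi$. An *approximate counting oracle* with cost $T^{\mathrm{ct}}_G$ for a model with partition function $Z$ takes $\delta>0$ and returns, in time $T^{\mathrm{ct}}_G(\delta)$, a random real $\hat Z$ with $\Pr[e^{-\delta}Z\le\hat Z\le e^{\delta}Z]\ge0.99$. Different calls use independent randomness. **Algorithms.** Algorithms are programs for a random access machine over the reals: arithmetic operations, $\exp$ and comparisons on reals, addition, truncated subtraction and comparison of natural numbers (used as addresses and counters), and memory accesses cost one unit of time each; the only constants in a program are natural numbers; a call to an oracle of the $k$-th model of $\mathcal F(\nu,\mu,\alpha)$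 with accuracy $\delta$ is charged its cost at $\delta$. The input consists of $n$, $m$, a list of the edges of $G$ on the vertex set $\{0,\dots,n-1\}$, the values of $J^\nu$ and $J^\mu$ along the edges, the vectors $h^\nu$ and $h^\mu$, and $\varepsilon$. **Theorem.** Let $\alpha\ge1$ be an integer and $b\in(0,1)$. There are an algorithm and constants $\eta_{\alpha,b}>0$ and $C_{\alpha,b}>0$, depending only on $\alpha$ and $b$, such that the following holds for every graph $G$ with $n\ge1$ vertices and $m$ edges, all Ising models $(G,J^\nu,h^\nu)$ and $(G,J^\mu,h^\mu)$, and every $0<\varepsilon<1$. If $\nu$ and $\mu$ are $b$-marginally bounded and every model in $\mathcal F(\nu,\mu,\alpha)$ has a sampling oracle and an approximate counting oracle with cost functions $T^{\mathrm{sp}}_G$ and $T^{\mathrm{ct}}_G$, then the algorithm, given access to these oracles, always halts within time $$C_{\alpha,b}\left(T^{\mathrm{ct}}_G\!\left(\frac{\eta_{\alpha,b}\,\varepsilon}{(n+m)^\alpha}\right)+\frac{(n+m)^{2\alpha}}{\varepsilon^2}\,T^{\mathrm{sp}}_G\!\left(\frac{\eta_{\alpha,b}\,\varepsilon^2}{(n+m)^{2\alpha}}\right)\right),$$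 and with probability at least $2/3$ its output $\hat D$ satisfies $e^{-\varepsilon}D_{\chi^\alpha}(\nu\,\|\,\mu)\le\hat D\le e^{\varepsilon}D_{\chi^\alpha}(\nu\,\|\,\mu)$. -/

import Mathlib

namespace IsingDiv

/-! ### Ising models, Gibbs distributions and divergences -/

/-- The spins `-1` and `+1`: the type `ℤˣ` has exactly these two elements. -/
abbrev Spin : Type := ℤˣ

/-- A configuration as a real vector with entries `-1` and `+1`. -/
def spinVec {V : Type*} (σ : V → Spin) : V → ℝ := fun v => ((σ v : ℤ) : ℝ)

/-- An Ising model on the graph `G`: a symmetric interaction matrix supported on the edges of `G`,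
and a vector of external fields. -/
structure IsingModel {V : Type*} (G : SimpleGraph V) where
  J : Matrix V V ℝ
  h : V → ℝ
  symm : J.IsSymm
  supp : ∀ u v, J u v ≠ 0 → G.Adj u v

namespace IsingModel

variable {V : Type*} [Fintype V] [DecidableEq V] {G : SimpleGraph V}

/-- The weight function `w(σ) = exp (σᵀ J σ / 2 + hᵀ σ)`. -/
noncomputable def weight (M : IsingModel G) (σ : V → Spin) : ℝ :=
  Real.exp (1 / 2 * (spinVec σ ⬝ᵥ M.J.mulVec (spinVec σ)) + M.h ⬝ᵥ spinVec σ)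

/-- The partition function. -/
noncomputable def Z (M : IsingModel G) : ℝ := ∑ σ : V → Spin, M.weight σ

/-- The Gibbs distribution, as a probability mass function with real values. -/
noncomputable def gibbs (M : IsingModel G) (σ : V → Spin) : ℝ := M.weight σ / M.Z

/-- The probability that vertex `v` has spin `c` under the Gibbs distribution, conditional on the
configuration on `Λ` being `τ`. -/
noncomputable def condMarginal (M : IsingModel G) (Λ : Finset V) (τ : Λ → Spin) (v : V)
    (c : Spin) : ℝ :=
  (∑ σ : V → Spin with (∀ u : Λ, σ u = τ u) ∧ σ v = c, M.gibbs σ) /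
    (∑ σ : V → Spin with ∀ u : Λ, σ u = τ u, M.gibbs σ)

/-- The `b`-marginal lower bound. -/
def MarginallyBounded (M : IsingModel G) (b : ℝ) : Prop :=
  ∀ (Λ : Finset V) (τ : Λ → Spin) (v : V), v ∉ Λ → ∀ c : Spin, b ≤ M.condMarginal Λ τ v c

/-- The Ising model with parameters `J = k Jν - (k - 1) Jμ` and `h = k hν - (k - 1) hμ`. -/
def interp {V : Type*} {G : SimpleGraph V} (ν μ : IsingModel G) (k : ℕ) : IsingModel G where
  J := (k : ℝ) • ν.J - ((k : ℝ) - 1) • μ.J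
  h := (k : ℝ) • ν.h - ((k : ℝ) - 1) • μ.h
  symm := (ν.symm.smul _).sub (μ.symm.smul _)
  supp u v huv := by
    by_contra hn
    have h1 : ν.J u v = 0 := by
      by_contra h
      exact hn (ν.supp u v h)
    have h2 : μ.J u v = 0 := by
      by_contra h
      exact hn (μ.supp u v h)
    simp [h1, h2] at huv

end IsingModel

/-- The `f`-divergence `∑ μ(x) f(ν(x) / μ(x))` of `ν` from `μ` on a finite set, for `μ` of full
support. -/
noncomputable def fDivergence {X : Type*} [Fintype X] (f : ℝ → ℝ) (ν μ : X → ℝ) : ℝ :=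
  ∑ x, μ x * f (ν x / μ x)

/-- The `χ^α`-divergence: the `f`-divergence for `f(x) = |x - 1|^α / 2`. -/
noncomputable def chiDivergence {X : Type*} [Fintype X] (α : ℕ) (ν μ : X → ℝ) : ℝ :=
  fDivergence (fun x => 1 / 2 * |x - 1| ^ α) ν μ

/-- Total variation distance of two probability mass functions on a finite set. -/
noncomputable def tvDist {X : Type*} [Fintype X] (p q : X → ℝ) : ℝ :=
  1 / 2 * ∑ x, |p x - q x|

/-! ### Oracles

An oracle is a randomized procedure: its answer is a function of the requested accuracy and of a
random seed `ξ`, drawn from a probability space `(Ω, P)` afresh for each call. -/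

/-- A cost function for oracles on a graph with `n` vertices and `m` edges: a non-increasing
function from the positive reals to `[n + m, ∞)`. -/
def IsCostFunction (n m : ℕ) (T : ℝ → ℝ) : Prop :=
  AntitoneOn T (Set.Ioi 0) ∧ ∀ δ : ℝ, 0 < δ → (n : ℝ) + m ≤ T δ

/-- With accuracy `δ`, a sampling oracle for `M` returns a random configuration whose law is
within total variation distance `δ` of the Gibbs distribution. -/
def IsSamplingOracle {Ω V : Type*} [MeasurableSpace Ω] [Fintype V] [DecidableEq V]
    {G : SimpleGraph V} (P : MeasureTheory.Measure Ω) (M : IsingModel G)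
    (S : ℝ → Ω → V → Spin) : Prop :=
  ∀ δ : ℝ, 0 < δ → (∀ σ : V → Spin, MeasurableSet {ξ | S δ ξ = σ}) ∧
    tvDist (fun σ => P.real {ξ | S δ ξ = σ}) M.gibbs ≤ δ

/-- With accuracy `δ`, an approximate counting oracle for `M` returns a random number that is
within a factor `exp (± δ)` of the partition function with probability at least `0.99`. -/
def IsCountingOracle {Ω V : Type*} [MeasurableSpace Ω] [Fintype V] [DecidableEq V]
    {G : SimpleGraph V} (P : MeasureTheory.Measure Ω) (M : IsingModel G)
    (A : ℝ → Ω → ℝ) : Prop :=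
  ∀ δ : ℝ, 0 < δ → Measurable (A δ) ∧
    99 / 100 ≤ P.real {ξ | Real.exp (-δ) * M.Z ≤ A δ ξ ∧ A δ ξ ≤ Real.exp δ * M.Z}

/-- Sampling and counting procedures for the models with indices `0, …, α` on `n` vertices,
together with the time charged for a call with a given accuracy. -/
structure Oracles (α n : ℕ) (Ω : Type*) where
  sample : Fin (α + 1) → ℝ → Ω → Fin n → Spin
  count : Fin (α + 1) → ℝ → Ω → ℝ
  sampleCost : ℝ → ℝ
  countCost : ℝ → ℝ

/-! ### The machine: a random access machine over the reals with oracle calls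

The memory consists of arrays of natural numbers and arrays of reals, numbered by `ℕ`. Natural
numbers serve as loop counters and addresses; the only constants in programs are natural numbers.
Every operation on natural numbers (addition, truncated subtraction, comparison) and on reals
(`+`, `-`, `*`, `/`, `exp`, comparison) and every memory access has unit cost. -/

/-- The memory, and the number of oracle calls made so far. -/
structure State where
  nat : ℕ → ℕ → ℕ
  real : ℕ → ℕ → ℝ
  calls : ℕ

/-- Expressions for natural numbers; `read a i` is the entry `i` of array `a`. -/
inductive NatExpr : Type
  | const (c : ℕ)
  | read (a : ℕ) (i : NatExpr)
  | add (e₁ e₂ : NatExpr)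
  | sub (e₁ e₂ : NatExpr)

namespace NatExpr

def eval (s : State) : NatExpr → ℕ
  | const c => c
  | read a i => s.nat a (i.eval s)
  | add e₁ e₂ => e₁.eval s + e₂.eval s
  | sub e₁ e₂ => e₁.eval s - e₂.eval s

/-- The number of operations in an expression. -/
def cost : NatExpr → ℕ
  | const _ => 1
  | read _ i => i.cost + 1
  | add e₁ e₂ => e₁.cost + e₂.cost + 1
  | sub e₁ e₂ => e₁.cost + e₂.cost + 1

end NatExpr

/-- Expressions for reals; `ofNat` reads a natural number as a real. -/
inductive RealExpr : Type
  | ofNat (e : NatExpr)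
  | read (a : ℕ) (i : NatExpr)
  | add (e₁ e₂ : RealExpr)
  | sub (e₁ e₂ : RealExpr)
  | mul (e₁ e₂ : RealExpr)
  | div (e₁ e₂ : RealExpr)
  | exp (e : RealExpr)

namespace RealExpr

/-- Values of expressions; a division by zero returns zero. -/
noncomputable def eval (s : State) : RealExpr → ℝ
  | ofNat e => (e.eval s : ℝ)
  | read a i => s.real a (i.eval s)
  | add e₁ e₂ => e₁.eval s + e₂.eval s
  | sub e₁ e₂ => e₁.eval s - e₂.eval s
  | mul e₁ e₂ => e₁.eval s * e₂.eval s
  | div e₁ e₂ => e₁.eval s / e₂.eval s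
  | exp e => Real.exp (e.eval s)

/-- The number of operations in an expression. -/
def cost : RealExpr → ℕ
  | ofNat e => e.cost + 1
  | read _ i => i.cost + 1
  | add e₁ e₂ => e₁.cost + e₂.cost + 1
  | sub e₁ e₂ => e₁.cost + e₂.cost + 1
  | mul e₁ e₂ => e₁.cost + e₂.cost + 1
  | div e₁ e₂ => e₁.cost + e₂.cost + 1
  | exp e => e.cost + 1

end RealExpr

/-- Tests for branches and loops. -/
inductive Test : Type
  | natLt (e₁ e₂ : NatExpr)
  | realLt (e₁ e₂ : RealExpr)

namespace Test

def holds (s : State) : Test → Prop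
  | natLt e₁ e₂ => e₁.eval s < e₂.eval s
  | realLt e₁ e₂ => e₁.eval s < e₂.eval s

def cost : Test → ℕ
  | natLt e₁ e₂ => e₁.cost + e₂.cost + 1
  | realLt e₁ e₂ => e₁.cost + e₂.cost + 1

end Test

/-- Programs. `setNat a i e` and `setReal a i e` store the value of `e` as entry `i` of array `a`;
`sample k acc a` calls the sampling oracle with index `k` and accuracy `acc` and stores the spins
as the first `n` entries of the real array `a`; `count k acc a i` calls the counting oracle with
index `k` and accuracy `acc` and stores its answer as entry `i` of the real array `a`. -/
inductive Program (α : ℕ) : Type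
  | setNat (a : ℕ) (i e : NatExpr)
  | setReal (a : ℕ) (i : NatExpr) (e : RealExpr)
  | seq (p q : Program α)
  | branch (t : Test) (p q : Program α)
  | loop (t : Test) (p : Program α)
  | sample (k : Fin (α + 1)) (acc : RealExpr) (a : ℕ)
  | count (k : Fin (α + 1)) (acc : RealExpr) (a : ℕ) (i : NatExpr)

namespace State

def setNat (s : State) (a i x : ℕ) : State :=
  { s with nat := fun a' i' => if a' = a ∧ i' = i then x else s.nat a' i' }

noncomputable def setReal (s : State) (a i : ℕ) (x : ℝ) : State :=
  { s with real := fun a' i' => if a' = a ∧ i' = i then x else s.real a' i' }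

/-- Overwrite the first `n` entries of the real array `a` by the vector `x`. -/
noncomputable def setVec (s : State) {n : ℕ} (a : ℕ) (x : Fin n → ℝ) : State :=
  { s with real := fun a' i' =>
      if a' = a then (if hi : i' < n then x ⟨i', hi⟩ else s.real a' i') else s.real a' i' }

/-- Record an oracle call. -/
def tick (s : State) : State := { s with calls := s.calls + 1 }

end State

/-- `Exec O ω p s s' t`: started in state `s`, and with `ω j` as the seed of the `j`-th oracle
call, the program `p` halts in state `s'` after total time `t`, oracle calls included. An oracle
call whose accuracy is not positive has no rule: the program then never halts. -/
inductive Exec {α n : ℕ} {Ω : Type*} (O : Oracles α n Ω) (ω : ℕ → Ω) :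
    Program α → State → State → ℝ → Prop
  | setNat (a : ℕ) (i e : NatExpr) (s : State) :
      Exec O ω (.setNat a i e) s (s.setNat a (i.eval s) (e.eval s)) (i.cost + e.cost + 1)
  | setReal (a : ℕ) (i : NatExpr) (e : RealExpr) (s : State) :
      Exec O ω (.setReal a i e) s (s.setReal a (i.eval s) (e.eval s)) (i.cost + e.cost + 1)
  | seq {p q : Program α} {s s' s'' : State} {t t' : ℝ} :
      Exec O ω p s s' t → Exec O ω q s' s'' t' → Exec O ω (.seq p q) s s'' (t + t')
  | branchTrue {c : Test} {p q : Program α} {s s' : State} {t : ℝ} :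
      c.holds s → Exec O ω p s s' t → Exec O ω (.branch c p q) s s' (c.cost + t)
  | branchFalse {c : Test} {p q : Program α} {s s' : State} {t : ℝ} :
      ¬ c.holds s → Exec O ω q s s' t → Exec O ω (.branch c p q) s s' (c.cost + t)
  | loopTrue {c : Test} {p : Program α} {s s' s'' : State} {t t' : ℝ} :
      c.holds s → Exec O ω p s s' t → Exec O ω (.loop c p) s' s'' t' →
        Exec O ω (.loop c p) s s'' (c.cost + t + t')
  | loopFalse {c : Test} {p : Program α} {s : State} :
      ¬ c.holds s → Exec O ω (.loop c p) s s c.cost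
  | sample (k : Fin (α + 1)) (acc : RealExpr) (a : ℕ) (s : State) :
      0 < acc.eval s →
        Exec O ω (.sample k acc a) s
          (s.setVec a (spinVec (O.sample k (acc.eval s) (ω s.calls)))).tick
          (acc.cost + O.sampleCost (acc.eval s) + 1)
  | count (k : Fin (α + 1)) (acc : RealExpr) (a : ℕ) (i : NatExpr) (s : State) :
      0 < acc.eval s →
        Exec O ω (.count k acc a i) s
          (s.setReal a (i.eval s) (O.count k (acc.eval s) (ω s.calls))).tick
          (acc.cost + i.cost + O.countCost (acc.eval s) + 1)

/-- Executions are deterministic once the seeds are fixed. -/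
theorem Exec.deterministic {α n : ℕ} {Ω : Type*} {O : Oracles α n Ω} {ω : ℕ → Ω}
    {p : Program α} {s s₁ s₂ : State} {t₁ t₂ : ℝ} (h₁ : Exec O ω p s s₁ t₁)
    (h₂ : Exec O ω p s s₂ t₂) : s₁ = s₂ ∧ t₁ = t₂ := by
  induction h₁ generalizing s₂ t₂ with
  | setNat => cases h₂; exact ⟨rfl, rfl⟩
  | setReal => cases h₂; exact ⟨rfl, rfl⟩
  | seq _ _ ih ih' =>
    cases h₂ with
    | seq h h' =>
      obtain ⟨rfl, rfl⟩ := ih h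
      obtain ⟨rfl, rfl⟩ := ih' h'
      exact ⟨rfl, rfl⟩
  | branchTrue hc _ ih =>
    cases h₂ with
    | branchTrue _ h =>
      obtain ⟨rfl, rfl⟩ := ih h
      exact ⟨rfl, rfl⟩
    | branchFalse hc' _ => exact absurd hc hc'
  | branchFalse hc _ ih =>
    cases h₂ with
    | branchTrue hc' _ => exact absurd hc' hc
    | branchFalse _ h =>
      obtain ⟨rfl, rfl⟩ := ih h
      exact ⟨rfl, rfl⟩
  | loopTrue hc _ _ ih ih' =>
    cases h₂ with
    | loopTrue _ h h' =>
      obtain ⟨rfl, rfl⟩ := ih h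
      obtain ⟨rfl, rfl⟩ := ih' h'
      exact ⟨rfl, rfl⟩
    | loopFalse hc' => exact absurd hc hc'
  | loopFalse hc =>
    cases h₂ with
    | loopTrue hc' _ _ => exact absurd hc' hc
    | loopFalse _ => exact ⟨rfl, rfl⟩
  | sample => cases h₂; exact ⟨rfl, rfl⟩
  | count => cases h₂; exact ⟨rfl, rfl⟩

/-! ### Input and output -/

/-- A list, in arbitrary order and with arbitrary orientations, of the edges of `G`, in which each
edge occurs exactly once. -/
structure EdgeList {V : Type*} (G : SimpleGraph V) (m : ℕ) where
  src : Fin m → V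
  dst : Fin m → V
  adj : ∀ i, G.Adj (src i) (dst i)
  bij : Function.Bijective fun i => (⟨s(src i, dst i), adj i⟩ : G.edgeSet)

/-- The array with the entries of `x`, followed by zeros. -/
def padded {R : Type*} [Zero R] {n : ℕ} (x : Fin n → R) (i : ℕ) : R :=
  if hi : i < n then x ⟨i, hi⟩ else 0

/-- The initial memory. Natural arrays: 0 holds `n, m`; 1 and 2 hold the endpoints of the edges.
Real arrays: 0 holds `ε`; 1 and 2 hold the interactions of `ν` and `μ` along the edges; 3 and 4
hold the external fields of `ν` and `μ`. All other entries are zero. -/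
noncomputable def inputState {n m : ℕ} {G : SimpleGraph (Fin n)} (E : EdgeList G m)
    (ν μ : IsingModel G) (ε : ℝ) : State where
  nat
    | 0 => padded ![n, m]
    | 1 => padded fun i => (E.src i : ℕ)
    | 2 => padded fun i => (E.dst i : ℕ)
    | _ => fun _ => 0
  real
    | 0 => padded ![ε]
    | 1 => padded fun i => ν.J (E.src i) (E.dst i)
    | 2 => padded fun i => μ.J (E.src i) (E.dst i)
    | 3 => padded ν.h
    | 4 => padded μ.h
    | _ => fun _ => 0
  calls := 0

/-- The output is the first entry of the real array 0. -/
def State.output (s : State) : ℝ := s.real 0 0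

end IsingDiv

open IsingDiv

/-!
Write `R = ν / μ` for the likelihood ratio of the Gibbs distributions, `f = logRatio ν μ` for the
logarithm of the ratio of the weights, so that `R = exp f * Z_μ / Z_ν`, and `N = n + m`. With the
bounded integrand `psi α r = |r - 1| ^ α / (1 + r ^ α)`,

  `2 D = E_μ |R - 1| ^ α = E_μ [psi α R] + T * E_π [psi α R]`,

where `π` is the `α`-th interpolating model and `T = E_μ [R ^ α]` is an expression in the partition
functions of the models `0`, `1` and `α` (`two_mul_chiDivergence_eq_psi`). So the algorithm needs
only one call of the counting oracle for each of these three models, and empirical means of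
`psi α R` over samples from the models `0` and `α`. Since `psi α r` depends on `r` continuously,
uniformly under relative errors of `r` (`abs_psi_sub_psi_le`), an approximation `θ` of `Z_μ / Z_ν`
may be used in place of the true ratio. The events for the samples can be stated with the true ratio
instead, so that they do not depend on the answers of the other calls.

How accurate must the means be? Let `L` be the `ℓ¹`-distance of the parameters. Under marginal
boundedness, reversing a spin changes `μ` by a bounded factor only. If `R` is close to `1` on
average, then it is so before and after a reversal, hence the local fields of the models are close
on average, and so are their parameters: `L` is at most of the order of `N E_μ |R - 1|`
(`paramDist_le`). By Jensen's inequality, `2 D` is at least of the order of `(min L 1 / N) ^ α`. As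
also `T ≤ 2 ^ α (1 + 2 D)` (`moment_le`), errors of the order of `ε (min L 1 / N) ^ α` in the two
means are harmless (`error_le`). The integrand is at most of the order of `(min L 1) ^ α`, so by
Chebyshev's inequality a multiple of `N ^ (2 α) / ε ^ 2` samples suffice. The relative error of `θ`
has to be of the order of `ε (min L 1) / N ^ α`. If `L ≥ 1`, then the counting oracles provide this.
If `L < 1`, then they are too inaccurate, but `Z_ν / Z_μ = E_μ [exp f]` is the expectation of a
random variable at distance at most `2 L` from `1`, and the mean over a further pass of samples from
`μ` is accurate enough (`abs_thetaHat_div_sub_one_le`).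

The program computes `L`, calls the counting oracles, and makes three passes of sampling. Its run is
described by `halts_setupProgram` and `halts_passesProgram`, in terms of a weakest-precondition
style predicate `Halts` that also bounds the running time.
-/

namespace IsingDiv

/-! ### Energies and likelihood ratios of Ising models -/

lemma abs_spinVec {V : Type*} (σ : V → Spin) (v : V) : |spinVec σ v| = 1 := by
  rcases Int.units_eq_one_or (σ v) with h | h <;> simp [spinVec, h]

/-- The configuration `σ` with the spin at `v` reversed. -/
def flip {V : Type*} [DecidableEq V] (v : V) (σ : V → Spin) : V → Spin :=
  Function.update σ v (-σ v)

lemma flip_involutive {V : Type*} [DecidableEq V] (v : V) :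
    Function.Involutive (flip (V := V) v) := by
  intro σ
  ext u
  by_cases h : u = v
  · subst h; simp [flip]
  · simp [flip, h]

lemma spinVec_flip_self {V : Type*} [DecidableEq V] (v : V) (σ : V → Spin) :
    spinVec (flip v σ) v = -spinVec σ v := by
  simp [spinVec, flip]

lemma spinVec_flip_of_ne {V : Type*} [DecidableEq V] {u v : V} (h : u ≠ v) (σ : V → Spin) :
    spinVec (flip v σ) u = spinVec σ u := by
  simp [spinVec, flip, h]

lemma spinVec_flip {V : Type*} [DecidableEq V] (v : V) (σ : V → Spin) :
    spinVec (flip v σ) = spinVec σ + Pi.single v (-2 * spinVec σ v) := by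
  ext u
  by_cases h : u = v
  · subst h; simp [spinVec_flip_self]; ring
  · simp [spinVec_flip_of_ne h, h]

lemma sum_comp_flip {V : Type*} [Fintype V] [DecidableEq V] (v : V) (g : (V → Spin) → ℝ) :
    ∑ σ, g (flip v σ) = ∑ σ, g σ :=
  Equiv.sum_comp (flip_involutive v).toPerm g

namespace IsingModel

variable {V : Type*} [Fintype V] [DecidableEq V] {G : SimpleGraph V}

/-- The exponent in the weight of a configuration. -/
noncomputable def energy (M : IsingModel G) (σ : V → Spin) : ℝ :=
  1 / 2 * (spinVec σ ⬝ᵥ M.J.mulVec (spinVec σ)) + M.h ⬝ᵥ spinVec σ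

/-- The local field `h_v + ∑ u, J_{vu} σ_u` at a vertex. -/
noncomputable def field (M : IsingModel G) (v : V) (σ : V → Spin) : ℝ :=
  M.h v + M.J.mulVec (spinVec σ) v

omit [Fintype V] [DecidableEq V] in
lemma J_self (M : IsingModel G) (v : V) : M.J v v = 0 := by
  by_contra h
  exact G.loopless.irrefl v (M.supp v v h)

omit [DecidableEq V] in
lemma weight_eq (M : IsingModel G) (σ : V → Spin) : M.weight σ = Real.exp (M.energy σ) := rfl

omit [DecidableEq V] in
lemma weight_pos (M : IsingModel G) (σ : V → Spin) : 0 < M.weight σ := Real.exp_pos _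

lemma Z_pos (M : IsingModel G) : 0 < M.Z :=
  Finset.sum_pos (fun σ _ => M.weight_pos σ) Finset.univ_nonempty

lemma gibbs_pos (M : IsingModel G) (σ : V → Spin) : 0 < M.gibbs σ :=
  div_pos (M.weight_pos σ) M.Z_pos

lemma sum_gibbs (M : IsingModel G) : ∑ σ, M.gibbs σ = 1 := by
  simp only [gibbs, ← Finset.sum_div]
  exact div_self M.Z_pos.ne'

/-- Reversing one spin changes the energy by the local field. -/
lemma energy_flip (M : IsingModel G) (v : V) (σ : V → Spin) :
    M.energy (flip v σ) - M.energy σ = -2 * spinVec σ v * M.field v σ := by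
  have hJ := M.J_self v
  have hs : spinVec σ ⬝ᵥ M.J.col v = M.J.mulVec (spinVec σ) v := by
    simp only [Matrix.mulVec, dotProduct, Matrix.col_apply]
    refine Finset.sum_congr rfl fun u _ => ?_
    rw [M.symm.apply v u]; ring
  simp only [energy, field, spinVec_flip, Matrix.mulVec_add, dotProduct_add, add_dotProduct,
    Matrix.mulVec_single, single_dotProduct, dotProduct_single, dotProduct_smul, hs]
  simp [hJ]
  ring

/-- Under the marginal bound, reversing one spin changes weights by a factor of at most `1 / b`. -/
lemma MarginallyBounded.weight_flip_le {M : IsingModel G} {b : ℝ} (hb : 0 < b)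
    (hM : M.MarginallyBounded b) (v : V) (σ : V → Spin) :
    M.weight (flip v σ) ≤ b⁻¹ * M.weight σ := by
  -- pin all spins but the one at `v`: only `σ` and its reversal are left
  have h := hM (Finset.univ.erase v) (fun u => σ u) v (by simp) (σ v)
  have hne : σ ≠ flip v σ := by
    intro h
    have := congrFun h v
    rcases Int.units_eq_one_or (σ v) with h | h <;> simp [flip, h] at this
  have h1 : (Finset.univ.filter fun ρ : V → Spin =>
      (∀ u : (Finset.univ.erase v : Finset V), ρ u = σ u) ∧ ρ v = σ v) = {σ} := by
    ext ρ
    simp only [Finset.mem_filter, Finset.mem_univ, true_and, Finset.mem_singleton]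
    constructor
    · rintro ⟨h1, h2⟩
      ext u
      by_cases hu : u = v
      · subst hu; rw [h2]
      · rw [h1 ⟨u, by simp [hu]⟩]
    · rintro rfl; simp
  have h2 : (Finset.univ.filter fun ρ : V → Spin =>
      ∀ u : (Finset.univ.erase v : Finset V), ρ u = σ u) = {σ, flip v σ} := by
    ext ρ
    simp only [Finset.mem_filter, Finset.mem_univ, true_and, Finset.mem_singleton,
      Finset.mem_insert]
    constructor
    · intro h1
      have h3 : ∀ u, u ≠ v → ρ u = σ u := fun u hu => h1 ⟨u, by simp [hu]⟩
      rcases Int.units_eq_one_or (ρ v) with hr | hr <;>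
      rcases Int.units_eq_one_or (σ v) with hs | hs
      · left; funext u; by_cases hu : u = v
        · rw [hu, hr, hs]
        · exact h3 u hu
      · right; funext u; by_cases hu : u = v
        · simp [hu, flip, hr, hs]
        · simp [flip, hu, h3 u hu]
      · right; funext u; by_cases hu : u = v
        · simp [hu, flip, hr, hs]
        · simp [flip, hu, h3 u hu]
      · left; funext u; by_cases hu : u = v
        · rw [hu, hr, hs]
        · exact h3 u hu
    · rintro (rfl | rfl) ⟨u, hu⟩
      · rfl
      · have : u ≠ v := by simpa using hu
        simp [flip, this]
  rw [condMarginal, h1, h2, Finset.sum_singleton, Finset.sum_pair hne, gibbs, gibbs, ← add_div,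
    div_div_div_cancel_right₀ M.Z_pos.ne',
    le_div_iff₀ (add_pos (M.weight_pos _) (M.weight_pos _))] at h
  rw [inv_mul_eq_div, le_div_iff₀ hb]
  nlinarith [mul_pos hb (M.weight_pos σ)]

/-- A nonnegative function loses at most a factor `1 / b` in expectation when one spin is
reversed. -/
lemma MarginallyBounded.sum_gibbs_flip_le {M : IsingModel G} {b : ℝ} (hb : 0 < b)
    (hM : M.MarginallyBounded b) (v : V) {g : (V → Spin) → ℝ} (hg : ∀ σ, 0 ≤ g σ) :
    ∑ σ, M.gibbs σ * g (flip v σ) ≤ b⁻¹ * ∑ σ, M.gibbs σ * g σ := by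
  rw [← sum_comp_flip v, Finset.mul_sum]
  refine Finset.sum_le_sum fun σ _ => ?_
  rw [flip_involutive v σ, ← mul_assoc]
  refine mul_le_mul_of_nonneg_right ?_ (hg σ)
  rw [gibbs, gibbs, ← mul_div_assoc]
  exact div_le_div_of_nonneg_right (hM.weight_flip_le hb v σ) M.Z_pos.le

/-- The logarithm of the ratio of the weights of two models. -/
noncomputable def logRatio (ν μ : IsingModel G) (σ : V → Spin) : ℝ := ν.energy σ - μ.energy σ

omit [DecidableEq V] in
lemma weight_interp (ν μ : IsingModel G) (k : ℕ) (σ : V → Spin) :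
    (ν.interp μ k).weight σ = μ.weight σ * Real.exp (logRatio ν μ σ) ^ k := by
  rw [← Real.exp_nat_mul, weight_eq, weight_eq, ← Real.exp_add]
  congr 1
  simp only [interp, energy, logRatio, Matrix.sub_mulVec, Matrix.smul_mulVec, dotProduct_sub,
    dotProduct_smul, sub_dotProduct, smul_dotProduct, smul_eq_mul]
  ring

lemma Z_interp_zero (ν μ : IsingModel G) : (ν.interp μ 0).Z = μ.Z := by
  simp [Z, weight_interp]

lemma gibbs_interp_zero (ν μ : IsingModel G) (σ : V → Spin) :
    (ν.interp μ 0).gibbs σ = μ.gibbs σ := by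
  simp [gibbs, Z_interp_zero, weight_interp]

omit [DecidableEq V] in
lemma weight_mul_exp_logRatio (ν μ : IsingModel G) (σ : V → Spin) :
    μ.weight σ * Real.exp (logRatio ν μ σ) = ν.weight σ := by
  rw [weight_eq, weight_eq, ← Real.exp_add, logRatio]; congr 1; ring

lemma Z_interp_one (ν μ : IsingModel G) : (ν.interp μ 1).Z = ν.Z := by
  simp [Z, weight_interp, weight_mul_exp_logRatio]

/-- The likelihood ratio `ν(σ) / μ(σ)`. -/
noncomputable def ratio (ν μ : IsingModel G) (σ : V → Spin) : ℝ :=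
  Real.exp (logRatio ν μ σ) * (μ.Z / ν.Z)

lemma gibbs_div_gibbs (ν μ : IsingModel G) (σ : V → Spin) :
    ν.gibbs σ / μ.gibbs σ = ratio ν μ σ := by
  have h1 := μ.weight_pos σ
  have h2 := μ.Z_pos
  have h3 := ν.Z_pos
  rw [gibbs, gibbs, ratio, ← weight_mul_exp_logRatio ν μ σ]
  field_simp

lemma ratio_pos (ν μ : IsingModel G) (σ : V → Spin) : 0 < ratio ν μ σ :=
  mul_pos (Real.exp_pos _) (div_pos μ.Z_pos ν.Z_pos)

/-- The normalizing factor `E_μ[(ν / μ) ^ k]`, in terms of partition functions. -/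
noncomputable def moment (ν μ : IsingModel G) (k : ℕ) : ℝ :=
  (ν.interp μ k).Z / μ.Z * (μ.Z / ν.Z) ^ k

lemma moment_pos (ν μ : IsingModel G) (k : ℕ) : 0 < moment ν μ k :=
  mul_pos (div_pos (Z_pos _) μ.Z_pos) (pow_pos (div_pos μ.Z_pos ν.Z_pos) _)

/-- Change of measure: `μ (ν / μ) ^ k` is a multiple of the `k`-th interpolating model. -/
lemma moment_mul_gibbs_interp (ν μ : IsingModel G) (k : ℕ) (σ : V → Spin) :
    moment ν μ k * (ν.interp μ k).gibbs σ = μ.gibbs σ * ratio ν μ σ ^ k := by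
  have h1 := (ν.interp μ k).Z_pos
  have h2 := μ.Z_pos
  rw [moment, gibbs, gibbs, weight_interp, ratio, mul_pow]
  field_simp

lemma moment_eq_sum (ν μ : IsingModel G) (k : ℕ) :
    moment ν μ k = ∑ σ, μ.gibbs σ * ratio ν μ σ ^ k := by
  simp only [← moment_mul_gibbs_interp, ← Finset.mul_sum, sum_gibbs, mul_one]

lemma two_mul_chiDivergence (ν μ : IsingModel G) (α : ℕ) :
    2 * chiDivergence α ν.gibbs μ.gibbs = ∑ σ, μ.gibbs σ * |ratio ν μ σ - 1| ^ α := by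
  simp only [chiDivergence, fDivergence, gibbs_div_gibbs, Finset.mul_sum]
  refine Finset.sum_congr rfl fun σ _ => ?_
  ring

end IsingModel

/-! ### Sums over an edge list -/

/-- Summing a symmetric function supported on the edges over ordered pairs of vertices counts every
edge twice. -/
lemma EdgeList.sum_sum_eq {V : Type*} [Fintype V] {G : SimpleGraph V} {m : ℕ} (E : EdgeList G m)
    {g : V → V → ℝ} (hsymm : ∀ u v, g u v = g v u) (hsupp : ∀ u v, ¬ G.Adj u v → g u v = 0) :
    ∑ u, ∑ v, g u v = 2 * ∑ i, g (E.src i) (E.dst i) := by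
  classical
  have hinj := E.bij.1
  have hval : ∀ i j, s(E.src i, E.dst i) = s(E.src j, E.dst j) → i = j := fun i j h =>
    hinj (Subtype.ext h)
  let F : Fin m × Bool → V × V := fun p =>
    if p.2 then (E.src p.1, E.dst p.1) else (E.dst p.1, E.src p.1)
  have hF : Function.Injective F := by
    rintro ⟨i, a⟩ ⟨j, c⟩ h
    have hij : i = j := by
      apply hval
      cases a <;> cases c <;> simp [F] at h <;> simp [h]
    subst hij
    have := (E.adj i).ne
    cases a <;> cases c <;> simp [F, this, this.symm] at h ⊢
  rw [← Fintype.sum_prod_type' , ← Finset.sum_subset (Finset.subset_univ (Finset.univ.image F)),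
    Finset.sum_image fun _ _ _ _ h => hF h, Fintype.sum_prod_type, Finset.mul_sum]
  · refine Finset.sum_congr rfl fun i _ => ?_
    simp [F, hsymm (E.dst i) (E.src i), two_mul]
  · rintro ⟨u, v⟩ - h
    refine hsupp u v fun huv => h ?_
    obtain ⟨i, hi⟩ := E.bij.2 ⟨s(u, v), huv⟩
    have hi' : s(E.src i, E.dst i) = s(u, v) := congrArg Subtype.val hi
    rcases Sym2.eq_iff.1 hi' with ⟨h1, h2⟩ | ⟨h1, h2⟩
    · exact Finset.mem_image.2 ⟨(i, true), Finset.mem_univ _, by simp [F, h1, h2]⟩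
    · exact Finset.mem_image.2 ⟨(i, false), Finset.mem_univ _, by simp [F, h1, h2]⟩

namespace IsingModel

section
variable {V : Type*} [Fintype V] {G : SimpleGraph V} {m : ℕ}

lemma energy_eq_sum_edges (M : IsingModel G) (E : EdgeList G m) (σ : V → Spin) :
    M.energy σ = (∑ i, M.J (E.src i) (E.dst i) * spinVec σ (E.src i) * spinVec σ (E.dst i)) +
      ∑ v, M.h v * spinVec σ v := by
  have h := E.sum_sum_eq (g := fun u v => M.J u v * spinVec σ u * spinVec σ v)
    (fun u v => by rw [M.symm.apply v u]; ring)
    (fun u v huv => by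
      have : M.J u v = 0 := by
        by_contra h
        exact huv (M.supp u v h)
      simp [this])
  have h2 : spinVec σ ⬝ᵥ M.J.mulVec (spinVec σ) =
      ∑ u, ∑ v, M.J u v * spinVec σ u * spinVec σ v := by
    simp only [dotProduct, Matrix.mulVec, Finset.mul_sum]
    refine Finset.sum_congr rfl fun u _ => Finset.sum_congr rfl fun v _ => by ring
  rw [energy, h2, h]
  simp only [dotProduct]
  ring

lemma logRatio_eq_sum_edges (ν μ : IsingModel G) (E : EdgeList G m) (σ : V → Spin) :
    logRatio ν μ σ = (∑ i, (ν.J (E.src i) (E.dst i) - μ.J (E.src i) (E.dst i)) *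
      spinVec σ (E.src i) * spinVec σ (E.dst i)) + ∑ v, (ν.h v - μ.h v) * spinVec σ v := by
  simp only [logRatio, energy_eq_sum_edges _ E, sub_mul, Finset.sum_sub_distrib]
  ring

/-- The `ℓ¹`-distance of the parameters of two models. -/
noncomputable def paramDist (ν μ : IsingModel G) (E : EdgeList G m) : ℝ :=
  (∑ i, |ν.J (E.src i) (E.dst i) - μ.J (E.src i) (E.dst i)|) + ∑ v, |ν.h v - μ.h v|

lemma paramDist_nonneg (ν μ : IsingModel G) (E : EdgeList G m) : 0 ≤ paramDist ν μ E := by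
  unfold paramDist; positivity

lemma abs_logRatio_le (ν μ : IsingModel G) (E : EdgeList G m) (σ : V → Spin) :
    |logRatio ν μ σ| ≤ paramDist ν μ E := by
  rw [logRatio_eq_sum_edges ν μ E, paramDist]
  refine (abs_add_le _ _).trans (add_le_add ?_ ?_) <;>
  · refine (Finset.abs_sum_le_sum_abs _ _).trans (Finset.sum_le_sum fun i _ => ?_)
    simp [abs_mul, abs_spinVec]

end

/-! ### The divergence dominates the distance of the parameters -/

section
variable {V : Type*} [Fintype V] [DecidableEq V] {G : SimpleGraph V} {m : ℕ}

/-- The `ℓ¹`-distance of two Gibbs distributions, written as `E_μ |ν / μ - 1|`. -/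
noncomputable def gibbsDist (ν μ : IsingModel G) : ℝ := ∑ σ, μ.gibbs σ * |ratio ν μ σ - 1|

lemma gibbsDist_nonneg (ν μ : IsingModel G) : 0 ≤ gibbsDist ν μ :=
  Finset.sum_nonneg fun σ _ => mul_nonneg (μ.gibbs_pos σ).le (abs_nonneg _)

/-- Jensen's inequality. -/
lemma gibbsDist_pow_le (ν μ : IsingModel G) (α : ℕ) :
    gibbsDist ν μ ^ α ≤ 2 * chiDivergence α ν.gibbs μ.gibbs := by
  rw [two_mul_chiDivergence]
  exact Real.pow_arith_mean_le_arith_mean_pow _ _ _ (fun σ _ => (μ.gibbs_pos σ).le) μ.sum_gibbs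
    (fun σ _ => abs_nonneg _) α

/-- If `r` and `r * exp x` are both close to `1`, then `x` is close to `0`. -/
lemma abs_le_of_exp_abs_le {r x B : ℝ} (hr : 0 < r) (hB : 1 ≤ B) (hx : Real.exp |x| ≤ B) :
    |x| ≤ 2 * B * (|r - 1| + |r * Real.exp x - 1|) := by
  have key : ∀ r x : ℝ, 0 < r → 0 ≤ x → Real.exp x ≤ B →
      x ≤ 2 * B * (|r - 1| + |r * Real.exp x - 1|) := by
    intro r x hr hx hB'
    have h1 := Real.add_one_le_exp x
    have h2 : 1 ≤ r + |r - 1| := by linarith [neg_abs_le (r - 1)]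
    have h3 : r * (x + 1) ≤ r * Real.exp x := mul_le_mul_of_nonneg_left h1 hr.le
    have h4 : r * x ≤ |r - 1| + |r * Real.exp x - 1| := by
      linarith [neg_abs_le (r - 1), le_abs_self (r * Real.exp x - 1)]
    have h5 : x * |r - 1| ≤ B * |r - 1| :=
      mul_le_mul_of_nonneg_right (by linarith) (abs_nonneg _)
    have h6 : x ≤ r * x + x * |r - 1| := by nlinarith
    have h7 := abs_nonneg (r * Real.exp x - 1)
    have h8 := abs_nonneg (r - 1)
    nlinarith
  rcases le_total 0 x with h | h
  · rw [abs_of_nonneg h] at hx ⊢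
    exact key r x hr h hx
  · rw [abs_of_nonpos h] at hx ⊢
    have := key (r * Real.exp x) (-x) (by positivity) (by linarith) hx
    have h1 : r * Real.exp x * Real.exp (-x) = r := by
      rw [mul_assoc, ← Real.exp_add, add_neg_cancel, Real.exp_zero, mul_one]
    rwa [h1, add_comm |_ - 1|] at this

variable {ν μ : IsingModel G} {b : ℝ}

lemma ratio_flip (ν μ : IsingModel G) (v : V) (σ : V → Spin) :
    ratio ν μ (flip v σ) =
      ratio ν μ σ * Real.exp (logRatio ν μ (flip v σ) - logRatio ν μ σ) := by
  rw [ratio, ratio, Real.exp_sub]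
  have := Real.exp_pos (logRatio ν μ σ)
  field_simp

lemma logRatio_flip (ν μ : IsingModel G) (v : V) (σ : V → Spin) :
    logRatio ν μ (flip v σ) - logRatio ν μ σ =
      -2 * spinVec σ v * (ν.field v σ - μ.field v σ) := by
  have h1 := ν.energy_flip v σ
  have h2 := μ.energy_flip v σ
  simp only [logRatio]
  linear_combination h1 - h2

lemma exp_logRatio_flip_le (hb : 0 < b) (hν : ν.MarginallyBounded b) (hμ : μ.MarginallyBounded b)
    (v : V) (σ : V → Spin) :
    Real.exp (logRatio ν μ (flip v σ) - logRatio ν μ σ) ≤ b⁻¹ ^ 2 := by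
  have h1 := hν.weight_flip_le hb v σ
  have h2 := hμ.weight_flip_le hb v (flip v σ)
  rw [flip_involutive v σ] at h2
  simp only [weight_eq] at h1 h2
  have h3 : Real.exp (ν.energy (flip v σ) - ν.energy σ) ≤ b⁻¹ := by
    rwa [Real.exp_sub, div_le_iff₀ (Real.exp_pos _)]
  have h4 : Real.exp (μ.energy σ - μ.energy (flip v σ)) ≤ b⁻¹ := by
    rwa [Real.exp_sub, div_le_iff₀ (Real.exp_pos _)]
  calc _ = Real.exp (ν.energy (flip v σ) - ν.energy σ) *
        Real.exp (μ.energy σ - μ.energy (flip v σ)) := by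
        rw [← Real.exp_add]; congr 1; simp only [logRatio]; ring
    _ ≤ b⁻¹ * b⁻¹ := mul_le_mul h3 h4 (Real.exp_pos _).le (by positivity)
    _ = _ := by ring

/-- Both sides of a spin reversal at `v` see a likelihood ratio close to `1`, so on average the
local fields at `v` are close. -/
lemma sum_gibbs_abs_field_sub_le (hb : 0 < b) (hb1 : b < 1) (hν : ν.MarginallyBounded b)
    (hμ : μ.MarginallyBounded b) (v : V) :
    ∑ σ, μ.gibbs σ * |ν.field v σ - μ.field v σ| ≤ 2 * b⁻¹ ^ 3 * gibbsDist ν μ := by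
  have hK : 1 ≤ b⁻¹ := (one_le_inv₀ hb).2 hb1.le
  have hpt : ∀ σ, |ν.field v σ - μ.field v σ| ≤
      b⁻¹ ^ 2 * (|ratio ν μ σ - 1| + |ratio ν μ (flip v σ) - 1|) := by
    intro σ
    have h1 := abs_le_of_exp_abs_le (r := ratio ν μ σ)
      (x := logRatio ν μ (flip v σ) - logRatio ν μ σ) (B := b⁻¹ ^ 2) (ratio_pos ν μ σ)
      (one_le_pow₀ hK) (by
        rcases abs_choice (logRatio ν μ (flip v σ) - logRatio ν μ σ) with h | h
        · rw [h]; exact exp_logRatio_flip_le hb hν hμ v σ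
        · rw [h, neg_sub]
          have := exp_logRatio_flip_le hb hν hμ v (flip v σ)
          rwa [flip_involutive v σ] at this)
    rw [← ratio_flip, logRatio_flip, abs_mul, abs_mul, abs_spinVec] at h1
    norm_num at h1 ⊢
    linarith
  have h2 := hμ.sum_gibbs_flip_le hb v (g := fun σ => |ratio ν μ σ - 1|) fun _ => abs_nonneg _
  have hA := gibbsDist_nonneg ν μ
  calc _ ≤ ∑ σ, μ.gibbs σ * (b⁻¹ ^ 2 * (|ratio ν μ σ - 1| + |ratio ν μ (flip v σ) - 1|)) :=
        Finset.sum_le_sum fun σ _ => mul_le_mul_of_nonneg_left (hpt σ) (μ.gibbs_pos σ).le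
    _ = b⁻¹ ^ 2 * (gibbsDist ν μ + ∑ σ, μ.gibbs σ * |ratio ν μ (flip v σ) - 1|) := by
        rw [gibbsDist, ← Finset.sum_add_distrib, Finset.mul_sum]
        exact Finset.sum_congr rfl fun σ _ => by ring
    _ ≤ b⁻¹ ^ 2 * (b⁻¹ * gibbsDist ν μ + b⁻¹ * gibbsDist ν μ) := by
        refine mul_le_mul_of_nonneg_left (add_le_add ?_ h2) (by positivity)
        nlinarith
    _ = _ := by ring

/-- Reversing a spin changes the field at another vertex by twice the interaction. -/
lemma field_flip (M : IsingModel G) (u v : V) (σ : V → Spin) :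
    M.field v (flip u σ) = M.field v σ - 2 * M.J v u * spinVec σ u := by
  simp only [field, spinVec_flip, Matrix.mulVec_add, Pi.add_apply, Matrix.mulVec_single]
  simp
  ring

lemma abs_J_sub_le (hb : 0 < b) (hb1 : b < 1) (hν : ν.MarginallyBounded b)
    (hμ : μ.MarginallyBounded b) (u v : V) :
    |ν.J v u - μ.J v u| ≤ 2 * b⁻¹ ^ 4 * gibbsDist ν μ := by
  have hK : 1 ≤ b⁻¹ := (one_le_inv₀ hb).2 hb1.le
  have hA := gibbsDist_nonneg ν μ
  set y : (V → Spin) → ℝ := fun σ => |ν.field v σ - μ.field v σ|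
  have h1 : ∀ σ, 2 * |ν.J v u - μ.J v u| ≤ y σ + y (flip u σ) := by
    intro σ
    have h2 : 2 * |ν.J v u - μ.J v u| = |2 * (ν.J v u - μ.J v u) * spinVec σ u| := by
      rw [abs_mul, abs_mul, abs_spinVec]; norm_num
    rw [h2]
    refine le_trans (le_of_eq ?_) (abs_sub (ν.field v σ - μ.field v σ)
      (ν.field v (flip u σ) - μ.field v (flip u σ)))
    rw [field_flip, field_flip]
    congr 1; ring
  have h2 : 2 * |ν.J v u - μ.J v u| ≤ ∑ σ, μ.gibbs σ * (y σ + y (flip u σ)) := by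
    calc _ = ∑ σ, μ.gibbs σ * (2 * |ν.J v u - μ.J v u|) := by
          rw [← Finset.sum_mul, sum_gibbs, one_mul]
      _ ≤ _ := Finset.sum_le_sum fun σ _ => mul_le_mul_of_nonneg_left (h1 σ) (μ.gibbs_pos σ).le
  simp only [mul_add, Finset.sum_add_distrib] at h2
  have h3 := hμ.sum_gibbs_flip_le hb u (g := y) fun _ => abs_nonneg _
  have h4 := sum_gibbs_abs_field_sub_le hb hb1 hν hμ v
  have h5 : b⁻¹ * ∑ σ, μ.gibbs σ * y σ ≤ b⁻¹ * (2 * b⁻¹ ^ 3 * gibbsDist ν μ) :=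
    mul_le_mul_of_nonneg_left h4 (by positivity)
  have h6 : 2 * b⁻¹ ^ 3 * gibbsDist ν μ ≤ b⁻¹ * (2 * b⁻¹ ^ 3 * gibbsDist ν μ) :=
    le_mul_of_one_le_left (by positivity) hK
  have h7 : b⁻¹ * (2 * b⁻¹ ^ 3 * gibbsDist ν μ) = 2 * b⁻¹ ^ 4 * gibbsDist ν μ := by ring
  simp only [y] at *
  linarith

lemma abs_h_sub_le (hb : 0 < b) (hb1 : b < 1) (hν : ν.MarginallyBounded b)
    (hμ : μ.MarginallyBounded b) (v : V) :
    |ν.h v - μ.h v| ≤ 2 * b⁻¹ ^ 3 * gibbsDist ν μ + ∑ u, |ν.J v u - μ.J v u| := by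
  have h1 : ∀ σ, |ν.h v - μ.h v| ≤
      |ν.field v σ - μ.field v σ| + ∑ u, |ν.J v u - μ.J v u| := by
    intro σ
    have h2 : ν.h v - μ.h v = (ν.field v σ - μ.field v σ) -
        ∑ u, (ν.J v u - μ.J v u) * spinVec σ u := by
      simp only [field, Matrix.mulVec, dotProduct, sub_mul, Finset.sum_sub_distrib]
      ring
    rw [h2]
    refine (abs_sub _ _).trans (add_le_add le_rfl ?_)
    refine (Finset.abs_sum_le_sum_abs _ _).trans (Finset.sum_le_sum fun u _ => ?_)
    rw [abs_mul, abs_spinVec, mul_one]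
  calc _ = ∑ σ, μ.gibbs σ * |ν.h v - μ.h v| := by rw [← Finset.sum_mul, sum_gibbs, one_mul]
    _ ≤ ∑ σ, μ.gibbs σ * (|ν.field v σ - μ.field v σ| + ∑ u, |ν.J v u - μ.J v u|) :=
        Finset.sum_le_sum fun σ _ => mul_le_mul_of_nonneg_left (h1 σ) (μ.gibbs_pos σ).le
    _ = (∑ σ, μ.gibbs σ * |ν.field v σ - μ.field v σ|) + ∑ u, |ν.J v u - μ.J v u| := by
        simp only [mul_add, Finset.sum_add_distrib]
        rw [← Finset.sum_mul, sum_gibbs, one_mul]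
    _ ≤ _ := add_le_add (sum_gibbs_abs_field_sub_le hb hb1 hν hμ v) le_rfl

/-- For marginally bounded models, the parameters are close if the Gibbs distributions are. -/
theorem paramDist_le (hb : 0 < b) (hb1 : b < 1) (hν : ν.MarginallyBounded b)
    (hμ : μ.MarginallyBounded b) (E : EdgeList G m) :
    paramDist ν μ E ≤ 6 * b⁻¹ ^ 4 * (Fintype.card V + m) * gibbsDist ν μ := by
  have hK : 1 ≤ b⁻¹ := (one_le_inv₀ hb).2 hb1.le
  have hA := gibbsDist_nonneg ν μ
  have h1 : ∑ v, ∑ u, |ν.J v u - μ.J v u| =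
      2 * ∑ i, |ν.J (E.src i) (E.dst i) - μ.J (E.src i) (E.dst i)| := by
    refine E.sum_sum_eq (fun u v => by rw [ν.symm.apply v u, μ.symm.apply v u]) fun u v huv => ?_
    have h1 : ν.J u v = 0 := by
      by_contra h
      exact huv (ν.supp u v h)
    have h2 : μ.J u v = 0 := by
      by_contra h
      exact huv (μ.supp u v h)
    simp [h1, h2]
  have h2 : ∑ v, |ν.h v - μ.h v| ≤ ∑ v : V, (2 * b⁻¹ ^ 3 * gibbsDist ν μ +
      ∑ u, |ν.J v u - μ.J v u|) := Finset.sum_le_sum fun v _ => abs_h_sub_le hb hb1 hν hμ v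
  have h3 : ∑ i, |ν.J (E.src i) (E.dst i) - μ.J (E.src i) (E.dst i)| ≤
      ∑ _i : Fin m, 2 * b⁻¹ ^ 4 * gibbsDist ν μ :=
    Finset.sum_le_sum fun i _ => abs_J_sub_le hb hb1 hν hμ _ _
  rw [Finset.sum_add_distrib, h1] at h2
  simp only [Finset.sum_const, Finset.card_univ, Fintype.card_fin, nsmul_eq_mul] at h2 h3
  have h4 : 2 * b⁻¹ ^ 3 * gibbsDist ν μ ≤ 2 * b⁻¹ ^ 4 * gibbsDist ν μ := by
    gcongr
    · norm_num
  have h5 : (Fintype.card V : ℝ) * (2 * b⁻¹ ^ 3 * gibbsDist ν μ) ≤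
      Fintype.card V * (2 * b⁻¹ ^ 4 * gibbsDist ν μ) := by gcongr
  have h6 : 0 ≤ (Fintype.card V : ℝ) * (2 * b⁻¹ ^ 4 * gibbsDist ν μ) := by positivity
  rw [paramDist]
  nlinarith

end
end IsingModel

/-! ### The bounded integrand -/

/-- The function `|r - 1| ^ α / (1 + r ^ α)`. -/
noncomputable def psi (α : ℕ) (r : ℝ) : ℝ := |r - 1| ^ α / (1 + r ^ α)

lemma psi_nonneg (α : ℕ) {r : ℝ} (hr : 0 ≤ r) : 0 ≤ psi α r := by unfold psi; positivity

lemma max_one_pow_le {r : ℝ} (hr : 0 ≤ r) (α : ℕ) : max 1 r ^ α ≤ 1 + r ^ α := by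
  have := pow_nonneg hr α
  rcases max_choice 1 r with h | h <;> rw [h]
  · simpa using this
  · linarith

/-- A bound on the deviation of `r` from `1` in units of `max 1 r` bounds `psi α r`. -/
lemma psi_le_pow {α : ℕ} {r c : ℝ} (hr : 0 ≤ r) (hc : 0 ≤ c) (h : |r - 1| ≤ c * max 1 r) :
    psi α r ≤ c ^ α := by
  rw [psi, div_le_iff₀ (by positivity)]
  calc |r - 1| ^ α ≤ (c * max 1 r) ^ α := pow_le_pow_left₀ (abs_nonneg _) h α
    _ = c ^ α * max 1 r ^ α := mul_pow _ _ _
    _ ≤ _ := mul_le_mul_of_nonneg_left (max_one_pow_le hr α) (by positivity)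

/-- A relative error `h` in `r` causes an error of order `h * lam ^ (α - 1)` in `psi α r` if the
deviation of `r` from `1` and the relative error are of order `lam`. -/
lemma abs_psi_sub_psi_le {α : ℕ} (hα : 1 ≤ α) {r y h lam : ℝ} (hr : 0 ≤ r) (hlam : 0 ≤ lam)
    (hlam1 : lam ≤ 1) (h1 : |r - 1| ≤ 16 * lam * max 1 r) (hy : |y| ≤ h) (hh : h ≤ lam)
    (hh' : α * 2 ^ α * h ≤ 1 / 2) :
    |psi α (r * (1 + y)) - psi α r| ≤ 4 * α * 32 ^ α * (h * lam ^ (α - 1)) := by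
  have hh0 : 0 ≤ h := (abs_nonneg y).trans hy
  set G := max 1 r with hG
  have hG0 : 0 ≤ G := le_max_of_le_left zero_le_one
  have hGr : r ≤ G := le_max_right _ _
  set N := 1 + r ^ α with hN
  set N' := 1 + (r * (1 + y)) ^ α with hN'
  have hN1 : 1 ≤ N := by rw [hN]; linarith [pow_nonneg hr α]
  have hGN : G ^ α ≤ N := max_one_pow_le hr α
  -- the change of the numerator
  have hd : |r * (1 + y) - 1 - (r - 1)| ≤ h * G := by
    rw [show r * (1 + y) - 1 - (r - 1) = y * r by ring, abs_mul, abs_of_nonneg hr]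
    exact mul_le_mul hy hGr hr hh0
  have h2 : |r * (1 + y) - 1| ≤ 17 * lam * G := by
    have h3 := abs_add_le (r * (1 + y) - 1 - (r - 1)) (r - 1)
    rw [sub_add_cancel] at h3
    nlinarith
  have hnum : |(|r * (1 + y) - 1| ^ α) - |r - 1| ^ α| ≤
      α * 17 ^ (α - 1) * (h * lam ^ (α - 1)) * N := by
    have h3 := abs_pow_sub_pow_le |r * (1 + y) - 1| |r - 1| α
    rw [abs_abs, abs_abs] at h3
    have h4 : max |r * (1 + y) - 1| |r - 1| ≤ 17 * lam * G :=
      max_le h2 (h1.trans (by nlinarith [mul_nonneg hlam hG0]))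
    calc _ ≤ _ := h3
      _ ≤ h * G * α * (17 * lam * G) ^ (α - 1) := by
          gcongr
          exact (abs_abs_sub_abs_le _ _).trans hd
      _ = α * 17 ^ (α - 1) * (h * lam ^ (α - 1)) * G ^ α := by
          obtain ⟨k, rfl⟩ : ∃ k, α = k + 1 := ⟨α - 1, by omega⟩
          simp only [Nat.add_sub_cancel]; ring
      _ ≤ _ := by gcongr
  -- the change of the denominator
  have hden : |N' - N| ≤ α * 2 ^ α * h * N := by
    have hy1 : |1 + y| ≤ 2 := by
      have := abs_add_le 1 y
      rw [abs_one] at this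
      linarith
    have h3 := abs_pow_sub_pow_le (1 + y) 1 α
    have h4 : |(1 + y) ^ α - 1| ≤ α * 2 ^ α * h := by
      calc _ = |(1 + y) ^ α - 1 ^ α| := by rw [one_pow]
        _ ≤ |1 + y - 1| * α * max |1 + y| |1| ^ (α - 1) := h3
        _ ≤ h * α * 2 ^ (α - 1) := by
            gcongr
            · simpa using hy
            · simpa using hy1
        _ ≤ h * α * 2 ^ α := by gcongr <;> norm_num
        _ = _ := by ring
    calc |N' - N| = r ^ α * |(1 + y) ^ α - 1| := by
          rw [hN, hN', mul_pow, ← abs_of_nonneg (pow_nonneg hr α), ← abs_mul,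
            abs_of_nonneg (pow_nonneg hr α)]
          congr 1; ring
      _ ≤ N * (α * 2 ^ α * h) := mul_le_mul (by rw [hN]; linarith) h4 (abs_nonneg _) (by linarith)
      _ = _ := by ring
  have hN'2 : N / 2 ≤ N' := by nlinarith [neg_abs_le (N' - N)]
  have hN'0 : 0 < N' := by linarith
  have hpsi : psi α r ≤ (16 * lam) ^ α := psi_le_pow hr (by positivity) h1
  have hpsi0 := psi_nonneg α hr
  have hid : psi α (r * (1 + y)) - psi α r =
      ((|r * (1 + y) - 1| ^ α - |r - 1| ^ α) - psi α r * (N' - N)) / N' := by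
    rw [psi, psi, ← hN, ← hN']
    field_simp
    ring
  have hlamα : lam ^ α ≤ lam ^ (α - 1) := pow_le_pow_of_le_one hlam hlam1 (by omega)
  rw [hid, abs_div, abs_of_pos hN'0, div_le_iff₀ hN'0]
  calc _ ≤ |(|r * (1 + y) - 1| ^ α) - |r - 1| ^ α| + |psi α r * (N' - N)| := abs_sub _ _
    _ ≤ α * 17 ^ (α - 1) * (h * lam ^ (α - 1)) * N + (16 * lam) ^ α * (α * 2 ^ α * h * N) := by
        refine add_le_add hnum ?_
        rw [abs_mul, abs_of_nonneg hpsi0]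
        exact mul_le_mul hpsi hden (abs_nonneg _) (by positivity)
    _ = α * (17 ^ (α - 1) * lam ^ (α - 1) + 32 ^ α * lam ^ α) * h * N := by
        rw [mul_pow, show (32 : ℝ) = 16 * 2 by norm_num, mul_pow]; ring
    _ ≤ α * (32 ^ α * lam ^ (α - 1) + 32 ^ α * lam ^ (α - 1)) * h * N := by
        gcongr
        calc (17 : ℝ) ^ (α - 1) ≤ 32 ^ (α - 1) := by gcongr; norm_num
          _ ≤ 32 ^ α := by gcongr <;> norm_num
    _ = 4 * α * 32 ^ α * (h * lam ^ (α - 1)) * (N / 2) := by ring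
    _ ≤ _ := by gcongr

namespace IsingModel
variable {V : Type*} [Fintype V] [DecidableEq V] {G : SimpleGraph V} {m : ℕ}

/-- The divergence is a combination of two expectations of a bounded function, one under `μ` and
one under the `α`-th interpolating model. -/
lemma two_mul_chiDivergence_eq_psi (ν μ : IsingModel G) (α : ℕ) :
    2 * chiDivergence α ν.gibbs μ.gibbs = (∑ σ, μ.gibbs σ * psi α (ratio ν μ σ)) +
      moment ν μ α * ∑ σ, (ν.interp μ α).gibbs σ * psi α (ratio ν μ σ) := by
  rw [two_mul_chiDivergence, Finset.mul_sum, ← Finset.sum_add_distrib]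
  refine Finset.sum_congr rfl fun σ _ => ?_
  have h := pow_pos (ratio_pos ν μ σ) α
  rw [← mul_assoc, moment_mul_gibbs_interp, psi]
  field_simp

/-- The `α`-th moment of the likelihood ratio is at most of the order of the divergence, or of
constant order. -/
lemma moment_le (ν μ : IsingModel G) (α : ℕ) :
    moment ν μ α ≤ 2 ^ α * (1 + 2 * chiDivergence α ν.gibbs μ.gibbs) := by
  rw [moment_eq_sum, two_mul_chiDivergence]
  calc _ ≤ ∑ σ, μ.gibbs σ * (2 ^ α * (1 + |ratio ν μ σ - 1| ^ α)) := by
        refine Finset.sum_le_sum fun σ _ => mul_le_mul_of_nonneg_left ?_ (μ.gibbs_pos σ).le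
        have h1 : ratio ν μ σ ≤ 2 * max 1 |ratio ν μ σ - 1| := by
          have h2 := le_abs_self (ratio ν μ σ - 1)
          have h3 := le_max_left 1 |ratio ν μ σ - 1|
          have h4 := le_max_right 1 |ratio ν μ σ - 1|
          linarith
        calc _ ≤ (2 * max 1 |ratio ν μ σ - 1|) ^ α :=
              pow_le_pow_left₀ (ratio_pos ν μ σ).le h1 α
          _ = 2 ^ α * max 1 |ratio ν μ σ - 1| ^ α := mul_pow _ _ _
          _ ≤ _ := mul_le_mul_of_nonneg_left (max_one_pow_le (abs_nonneg _) α) (by positivity)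
    _ = _ := by
        simp only [mul_add, mul_one, Finset.sum_add_distrib]
        rw [← Finset.sum_mul, sum_gibbs, one_mul, Finset.mul_sum]
        congr 1
        exact Finset.sum_congr rfl fun σ _ => by ring

lemma Z_div_Z_eq_sum (ν μ : IsingModel G) :
    ν.Z / μ.Z = ∑ σ, μ.gibbs σ * Real.exp (logRatio ν μ σ) := by
  simp only [gibbs, div_mul_eq_mul_div, weight_mul_exp_logRatio, ← Finset.sum_div, Z]

/-- The ratio of the partition functions is an average of values of `exp (logRatio ν μ)`. -/
lemma Z_div_Z_mem_exp (ν μ : IsingModel G) (E : EdgeList G m) :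
    Real.exp (-paramDist ν μ E) ≤ ν.Z / μ.Z ∧ ν.Z / μ.Z ≤ Real.exp (paramDist ν μ E) := by
  rw [Z_div_Z_eq_sum]
  have h := fun σ => abs_le.1 (abs_logRatio_le ν μ E σ)
  constructor
  · calc _ = ∑ σ, μ.gibbs σ * Real.exp (-paramDist ν μ E) := by
          rw [← Finset.sum_mul, sum_gibbs, one_mul]
      _ ≤ _ := Finset.sum_le_sum fun σ _ =>
          mul_le_mul_of_nonneg_left (Real.exp_le_exp.2 (h σ).1) (μ.gibbs_pos σ).le
  · calc _ ≤ ∑ σ, μ.gibbs σ * Real.exp (paramDist ν μ E) := Finset.sum_le_sum fun σ _ =>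
          mul_le_mul_of_nonneg_left (Real.exp_le_exp.2 (h σ).2) (μ.gibbs_pos σ).le
      _ = _ := by rw [← Finset.sum_mul, sum_gibbs, one_mul]

lemma abs_exp_sub_one_le_of_abs_le {x L : ℝ} (hx : |x| ≤ L) (hL : L ≤ 1) :
    |Real.exp x - 1| ≤ 2 * L :=
  (Real.abs_exp_sub_one_le (hx.trans hL)).trans (by linarith)

/-- In units of `max 1 (ν / μ)`, the deviation of the likelihood ratio from `1` is of the order of
the distance of the parameters, truncated at `1`. -/
lemma abs_ratio_sub_one_le (ν μ : IsingModel G) (E : EdgeList G m) (σ : V → Spin) :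
    |ratio ν μ σ - 1| ≤ 16 * min (paramDist ν μ E) 1 * max 1 (ratio ν μ σ) := by
  have hr := ratio_pos ν μ σ
  have hL0 := paramDist_nonneg ν μ E
  have hG1 : 1 ≤ max 1 (ratio ν μ σ) := le_max_left _ _
  have hGr : ratio ν μ σ ≤ max 1 (ratio ν μ σ) := le_max_right _ _
  rcases le_total 1 (paramDist ν μ E) with h | h
  · rw [min_eq_right h, abs_le]
    constructor <;> linarith
  · rw [min_eq_left h]
    set L := paramDist ν μ E
    obtain ⟨h1, h2⟩ := Z_div_Z_mem_exp ν μ E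
    have hZ : 0 < ν.Z / μ.Z := div_pos ν.Z_pos μ.Z_pos
    have he1 : |Real.exp (logRatio ν μ σ) - 1| ≤ 2 * L :=
      abs_exp_sub_one_le_of_abs_le (abs_logRatio_le ν μ E σ) h
    have he2 : |ν.Z / μ.Z - 1| ≤ 2 * L := by
      have h3 := abs_le.1 (abs_exp_sub_one_le_of_abs_le (x := L) (by rw [abs_of_nonneg hL0]) h)
      have h4 := abs_le.1
        (abs_exp_sub_one_le_of_abs_le (x := -L) (by rw [abs_neg, abs_of_nonneg hL0]) h)
      rw [abs_le]
      constructor <;> linarith [h3.1, h3.2, h4.1, h4.2]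
    have hlow : 1 / 3 ≤ ν.Z / μ.Z := by
      refine le_trans ?_ h1
      have h5 : Real.exp L ≤ 3 :=
        (Real.exp_le_exp.2 h).trans (Real.exp_one_lt_d9.le.trans (by norm_num))
      rw [Real.exp_neg, one_div]
      exact inv_anti₀ (Real.exp_pos _) h5
    have hid : ratio ν μ σ - 1 =
        ((Real.exp (logRatio ν μ σ) - 1) - (ν.Z / μ.Z - 1)) / (ν.Z / μ.Z) := by
      have := ν.Z_pos
      have := μ.Z_pos
      rw [ratio]; field_simp; ring
    have h6 : |ratio ν μ σ - 1| ≤ 16 * L := by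
      rw [hid, abs_div, abs_of_pos hZ, div_le_iff₀ hZ]
      have := abs_sub (Real.exp (logRatio ν μ σ) - 1) (ν.Z / μ.Z - 1)
      nlinarith
    nlinarith

end IsingModel

/-! ### Empirical means of oracle answers -/

section
open MeasureTheory ProbabilityTheory

variable {X : Type*} [Fintype X] {Ω : Type*} [MeasurableSpace Ω]

omit [MeasurableSpace Ω] in
lemma comp_eq_sum_indicator (S : Ω → X) (F : X → ℝ) :
    (fun ξ => F (S ξ)) = fun ξ => ∑ x, {ξ | S ξ = x}.indicator (fun _ => F x) ξ := by
  classical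
  funext ξ
  simp [Set.indicator_apply]

lemma measurable_comp_of_fibers {S : Ω → X} (hS : ∀ x, MeasurableSet {ξ | S ξ = x})
    (F : X → ℝ) : Measurable fun ξ => F (S ξ) := by
  rw [comp_eq_sum_indicator]
  exact Finset.measurable_sum _ fun x _ => measurable_const.indicator (hS x)

lemma integral_comp_eq_sum {S : Ω → X} (hS : ∀ x, MeasurableSet {ξ | S ξ = x})
    (P : Measure Ω) [IsProbabilityMeasure P] (F : X → ℝ) :
    ∫ ξ, F (S ξ) ∂P = ∑ x, P.real {ξ | S ξ = x} * F x := by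
  rw [comp_eq_sum_indicator, integral_finsetSum]
  · exact Finset.sum_congr rfl fun x _ => by rw [integral_indicator_const _ (hS x), smul_eq_mul]
  · exact fun x _ => (integrable_const _).indicator (hS x)

lemma abs_integral_comp_sub_le {S : Ω → X} (hS : ∀ x, MeasurableSet {ξ | S ξ = x})
    (P : Measure Ω) [IsProbabilityMeasure P] {q : X → ℝ} {δ : ℝ}
    (hδ : tvDist (fun x => P.real {ξ | S ξ = x}) q ≤ δ) {F : X → ℝ} {B : ℝ} (hB0 : 0 ≤ B)
    (hB : ∀ x, |F x| ≤ B) : |∫ ξ, F (S ξ) ∂P - ∑ x, q x * F x| ≤ 2 * δ * B := by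
  rw [integral_comp_eq_sum hS, ← Finset.sum_sub_distrib]
  calc _ ≤ ∑ x, |P.real {ξ | S ξ = x} * F x - q x * F x| := Finset.abs_sum_le_sum_abs _ _
    _ ≤ ∑ x, |P.real {ξ | S ξ = x} - q x| * B := by
        refine Finset.sum_le_sum fun x _ => ?_
        rw [← sub_mul, abs_mul]
        exact mul_le_mul_of_nonneg_left (hB x) (abs_nonneg _)
    _ = 2 * tvDist (fun x => P.real {ξ | S ξ = x}) q * B := by
        rw [tvDist, ← Finset.sum_mul]; ring
    _ ≤ _ := by gcongr

/-- The mean of `M` values of `Y` at consecutive seeds. -/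
noncomputable def seedMean {Ω : Type*} (Y : Ω → ℝ) (c M : ℕ) (ω : ℕ → Ω) : ℝ :=
  (∑ j ∈ Finset.range M, Y (ω (c + j))) / M

lemma measurable_seedMean {Y : Ω → ℝ} (hY : Measurable Y) (c M : ℕ) :
    Measurable (seedMean Y c M) :=
  (Finset.measurable_sum _ fun j _ => hY.comp (measurable_pi_apply (c + j))).div_const _

/-- Chebyshev's inequality for the mean of bounded functions of independent seeds. -/
lemma measureReal_seedMean_le {P : Measure Ω} [IsProbabilityMeasure P] {Y : Ω → ℝ}
    (hY : Measurable Y) {B : ℝ} (hB : ∀ ξ, |Y ξ| ≤ B) (c : ℕ) {M : ℕ} (hM : 0 < M) {t : ℝ}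
    (ht : 0 < t) :
    (Measure.infinitePi fun _ : ℕ => P).real
      {ω | t * B < |seedMean Y c M ω - ∫ ξ, Y ξ ∂P|} ≤ 1 / (M * t ^ 2) := by
  set Q := Measure.infinitePi fun _ : ℕ => P
  have hM' : (0 : ℝ) < M := by exact_mod_cast hM
  obtain ⟨ω₀⟩ : Nonempty Ω := nonempty_of_isProbabilityMeasure P
  have hB0 : 0 ≤ B := (abs_nonneg _).trans (hB ω₀)
  have hmeas : ∀ j, Measurable fun ω : ℕ → Ω => Y (ω j) := fun j =>
    hY.comp (measurable_pi_apply j)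
  have hint : ∀ j, ∫ ω, Y (ω j) ∂Q = ∫ ξ, Y ξ ∂P := by
    intro j
    rw [← Measure.infinitePi_map_eval (fun _ : ℕ => P) j,
      integral_map (measurable_pi_apply j).aemeasurable hY.aestronglyMeasurable]
  rcases hB0.eq_or_lt with rfl | hBpos
  · have h0 : ∀ ξ, Y ξ = 0 := fun ξ => abs_nonpos_iff.1 (hB ξ)
    simp only [seedMean, h0]
    simp
    positivity
  have hmem : ∀ j, MemLp (fun ω : ℕ → Ω => Y (ω j)) 2 Q := fun j =>
    MemLp.of_bound (hmeas j).aestronglyMeasurable B (Filter.Eventually.of_forall fun ω => by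
      simpa using hB (ω j))
  set T : (ℕ → Ω) → ℝ := ∑ j ∈ Finset.range M, fun ω => Y (ω (c + j)) with hT
  have hTmem : MemLp T 2 Q := memLp_finsetSum' _ fun j _ => hmem _
  have hvar : Var[T; Q] ≤ M * B ^ 2 := by
    rw [hT, IndepFun.variance_sum fun j _ => hmem _]
    · calc _ ≤ ∑ j ∈ Finset.range M, B ^ 2 := by
            refine Finset.sum_le_sum fun j _ => ?_
            have := variance_le_sq_of_bounded (μ := Q) (a := -B) (b := B)
              (X := fun ω => Y (ω (c + j)))
              (Filter.Eventually.of_forall fun ω => abs_le.1 (hB _)) (hmeas _).aemeasurable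
            rwa [sub_neg_eq_add, add_self_div_two] at this
        _ = _ := by simp
    · intro i _ j _ hij
      exact (iIndepFun_infinitePi (P := fun _ : ℕ => P) (X := fun _ => Y) fun _ => hY).indepFun
        (by omega : c + i ≠ c + j)
  have hmean : ∫ ω, T ω ∂Q = M * ∫ ξ, Y ξ ∂P := by
    simp only [hT, Finset.sum_apply]
    rw [integral_finsetSum _ fun j _ => (hmem _).integrable (by norm_num)]
    simp [hint]
  have hcheb := meas_ge_le_variance_div_sq hTmem (c := M * (t * B)) (by positivity)
  have hsub : {ω | t * B < |seedMean Y c M ω - ∫ ξ, Y ξ ∂P|} ⊆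
      {ω | M * (t * B) ≤ |T ω - ∫ ω, T ω ∂Q|} := by
    intro ω hω
    have h1 : T ω - ∫ ω, T ω ∂Q = M * (seedMean Y c M ω - ∫ ξ, Y ξ ∂P) := by
      rw [hmean, seedMean, hT, Finset.sum_apply]
      field_simp
    rw [Set.mem_ofPred_eq, h1, abs_mul, abs_of_pos hM']
    exact mul_le_mul_of_nonneg_left (le_of_lt hω) hM'.le
  calc _ ≤ Q.real {ω | M * (t * B) ≤ |T ω - ∫ ω, T ω ∂Q|} := measureReal_mono hsub
    _ ≤ Var[T; Q] / (M * (t * B)) ^ 2 :=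
        ENNReal.toReal_le_of_le_ofReal (div_nonneg (variance_nonneg _ _) (by positivity)) hcheb
    _ ≤ (M * B ^ 2) / (M * (t * B)) ^ 2 := by gcongr
    _ = _ := by field_simp

/-- The empirical mean of a bounded function of the answers of an approximate sampler is close to
its expectation. -/
lemma measureReal_seedMean_comp_le {P : Measure Ω} [IsProbabilityMeasure P] {S : Ω → X}
    (hS : ∀ x, MeasurableSet {ξ | S ξ = x}) {q : X → ℝ} {δ : ℝ}
    (hδ : tvDist (fun x => P.real {ξ | S ξ = x}) q ≤ δ) {F : X → ℝ} {B : ℝ}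
    (hB : ∀ x, |F x| ≤ B) (c : ℕ) {M : ℕ} (hM : 0 < M) {t : ℝ} (ht : 0 < t) :
    (Measure.infinitePi fun _ : ℕ => P).real
      {ω | (t + 2 * δ) * B < |seedMean (fun ξ => F (S ξ)) c M ω - ∑ x, q x * F x|} ≤
        1 / (M * t ^ 2) := by
  obtain ⟨ω₀⟩ : Nonempty Ω := nonempty_of_isProbabilityMeasure P
  refine le_trans (measureReal_mono fun ω hω => ?_) (measureReal_seedMean_le
    (measurable_comp_of_fibers hS F) (fun ξ => hB (S ξ)) c hM ht)
  have h1 := abs_integral_comp_sub_le hS P hδ ((abs_nonneg _).trans (hB (S ω₀))) hB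
  have h2 := abs_sub_le (seedMean (fun ξ => F (S ξ)) c M ω) (∫ ξ, F (S ξ) ∂P) (∑ x, q x * F x)
  simp only [Set.mem_ofPred_eq] at hω ⊢
  linarith

/-- An event that concerns one seed has the same probability for each call. -/
lemma measureReal_seed (P : Measure Ω) [IsProbabilityMeasure P] (j : ℕ) {s : Set Ω}
    (hs : MeasurableSet s) :
    (Measure.infinitePi fun _ : ℕ => P).real {ω | ω j ∈ s} = P.real s :=
  (measurePreserving_eval_infinitePi (fun _ : ℕ => P) j).measureReal_preimage hs.nullMeasurableSet

end

/-! ### Accuracy of the estimate -/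

lemma abs_seedMean_sub_le {Ω : Type*} {Y Y' : Ω → ℝ} {e : ℝ} (h : ∀ ξ, |Y ξ - Y' ξ| ≤ e)
    (c : ℕ) {M : ℕ} (hM : 0 < M) (ω : ℕ → Ω) : |seedMean Y c M ω - seedMean Y' c M ω| ≤ e := by
  have hM' : (0 : ℝ) < M := by exact_mod_cast hM
  rw [seedMean, seedMean, ← sub_div, ← Finset.sum_sub_distrib, abs_div, abs_of_pos hM',
    div_le_iff₀ hM']
  calc _ ≤ ∑ j ∈ Finset.range M, |Y (ω (c + j)) - Y' (ω (c + j))| :=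
        Finset.abs_sum_le_sum_abs _ _
    _ ≤ ∑ _j ∈ Finset.range M, e := Finset.sum_le_sum fun j _ => h _
    _ = _ := by simp [mul_comm]

/-- `z` approximates `Z` within a factor `exp (± δ)`. -/
lemma exists_eq_mul_exp {z Z δ : ℝ} (hZ : 0 < Z) (h1 : Real.exp (-δ) * Z ≤ z)
    (h2 : z ≤ Real.exp δ * Z) : ∃ x, |x| ≤ δ ∧ z = Z * Real.exp x := by
  have hz : 0 < z := lt_of_lt_of_le (by positivity) h1
  refine ⟨Real.log (z / Z), ?_, ?_⟩
  · rw [abs_le]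
    constructor
    · rw [Real.le_log_iff_exp_le (by positivity), le_div_iff₀ hZ]; exact h1
    · rw [Real.log_le_iff_le_exp (by positivity), div_le_iff₀ hZ]; exact h2
  · rw [Real.exp_log (by positivity)]; field_simp

/-- The approximation of the ratio `μ.Z / ν.Z` that the algorithm uses: the inverse of an empirical
mean `a` of `exp (logRatio ν μ)` if the parameters of the models are at distance `L < 1`, and the
quotient of the answers `z₀`, `z₁` of the counting oracles otherwise. -/
noncomputable def thetaHat (L a z₀ z₁ : ℝ) : ℝ :=
  open Classical in if L < 1 then 1 / a else z₀ / z₁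

namespace IsingModel
variable {V : Type*} [Fintype V] [DecidableEq V] {G : SimpleGraph V} {m : ℕ}

/-- The relative error of the approximate ratio of the partition functions is proportional to the
distance of the models, if that is small. -/
lemma abs_thetaHat_div_sub_one_le (ν μ : IsingModel G) (E : EdgeList G m) {a z₀ z₁ s δ : ℝ}
    (hs : 24 * s ≤ 1) (hδ : δ ≤ s)
    (ha : paramDist ν μ E < 1 → |a - ν.Z / μ.Z| ≤ s * (2 * min (paramDist ν μ E) 1))
    (h0 : Real.exp (-δ) * μ.Z ≤ z₀ ∧ z₀ ≤ Real.exp δ * μ.Z)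
    (h1 : Real.exp (-δ) * ν.Z ≤ z₁ ∧ z₁ ≤ Real.exp δ * ν.Z) :
    |thetaHat (paramDist ν μ E) a z₀ z₁ / (μ.Z / ν.Z) - 1| ≤
      12 * s * min (paramDist ν μ E) 1 := by
  have hμ := μ.Z_pos
  have hν := ν.Z_pos
  have hZ : 0 < ν.Z / μ.Z := div_pos hν hμ
  obtain ⟨x₀, hx₀, rfl⟩ := exists_eq_mul_exp hμ h0.1 h0.2
  obtain ⟨x₁, hx₁, rfl⟩ := exists_eq_mul_exp hν h1.1 h1.2
  have hs0 : 0 ≤ s := ((abs_nonneg _).trans hx₀).trans hδ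
  rw [thetaHat]
  split_ifs with h
  · have ha' := ha h
    rw [min_eq_left h.le] at ha' ⊢
    set L := paramDist ν μ E
    have hL0 : 0 ≤ L := paramDist_nonneg ν μ E
    have h2 := (Z_div_Z_mem_exp ν μ E).1
    have h3 : 1 / 3 ≤ ν.Z / μ.Z := by
      refine le_trans ?_ h2
      have h5 : Real.exp L ≤ 3 :=
        (Real.exp_le_exp.2 h.le).trans (Real.exp_one_lt_d9.le.trans (by norm_num))
      rw [Real.exp_neg, one_div]
      exact inv_anti₀ (Real.exp_pos _) h5
    have h4 := abs_le.1 ha'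
    have hsL : s * L ≤ s := by nlinarith
    have ha0 : 1 / 6 ≤ a := by nlinarith
    have hapos : 0 < a := by linarith
    have hid : 1 / a / (μ.Z / ν.Z) - 1 = -(a - ν.Z / μ.Z) / a := by
      field_simp
      ring
    rw [hid, abs_div, abs_neg, abs_of_pos hapos, div_le_iff₀ hapos]
    have : 0 ≤ s * L := mul_nonneg hs0 hL0
    nlinarith
  · have hL := not_lt.1 h
    rw [min_eq_right hL, mul_one]
    have hid : μ.Z * Real.exp x₀ / (ν.Z * Real.exp x₁) / (μ.Z / ν.Z) = Real.exp (x₀ - x₁) := by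
      rw [Real.exp_sub]
      field_simp
    have h2 : |x₀ - x₁| ≤ 2 * s := by
      have := abs_sub x₀ x₁
      linarith
    rw [hid]
    have := Real.abs_exp_sub_one_le (x := x₀ - x₁) (by linarith)
    linarith

/-- The relative error of the approximation of `moment ν μ α` by counting oracles. -/
lemma abs_momentHat_sub_le (ν μ : IsingModel G) {α : ℕ} (hα : 1 ≤ α) {z₀ z₁ z δ : ℝ}
    (hδ : 4 * α * δ ≤ 1)
    (h0 : Real.exp (-δ) * μ.Z ≤ z₀ ∧ z₀ ≤ Real.exp δ * μ.Z)
    (h1 : Real.exp (-δ) * ν.Z ≤ z₁ ∧ z₁ ≤ Real.exp δ * ν.Z)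
    (h : Real.exp (-δ) * (ν.interp μ α).Z ≤ z ∧ z ≤ Real.exp δ * (ν.interp μ α).Z) :
    |z / z₀ * (z₀ / z₁) ^ α - moment ν μ α| ≤ 8 * α * δ * moment ν μ α := by
  have hμ := μ.Z_pos
  have hν := ν.Z_pos
  have hi := (ν.interp μ α).Z_pos
  obtain ⟨x₀, hx₀, rfl⟩ := exists_eq_mul_exp hμ h0.1 h0.2
  obtain ⟨x₁, hx₁, rfl⟩ := exists_eq_mul_exp hν h1.1 h1.2
  obtain ⟨x, hx, rfl⟩ := exists_eq_mul_exp hi h.1 h.2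
  have hα' : (1 : ℝ) ≤ α := by exact_mod_cast hα
  have hδ0 : 0 ≤ δ := (abs_nonneg _).trans hx₀
  have hid : (ν.interp μ α).Z * Real.exp x / (μ.Z * Real.exp x₀) *
      (μ.Z * Real.exp x₀ / (ν.Z * Real.exp x₁)) ^ α - moment ν μ α =
      (Real.exp (x - x₀ + α * (x₀ - x₁)) - 1) * moment ν μ α := by
    rw [moment, Real.exp_add, Real.exp_nat_mul, Real.exp_sub, Real.exp_sub, mul_div_mul_comm μ.Z,
      mul_pow]
    field_simp
  rw [hid, abs_mul, abs_of_pos (moment_pos ν μ α)]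
  refine mul_le_mul_of_nonneg_right ?_ (moment_pos ν μ α).le
  have h2 : |x - x₀ + α * (x₀ - x₁)| ≤ 4 * α * δ := by
    have h3 := abs_add_le (x - x₀) (α * (x₀ - x₁))
    have h4 := abs_sub x x₀
    have h5 := abs_sub x₀ x₁
    rw [abs_mul, Nat.abs_cast] at h3
    nlinarith
  have := Real.abs_exp_sub_one_le (h2.trans hδ)
  linarith

/-- If the means of the bounded integrand are known up to an additive error `e` and the moment up
to a relative error `ε / 4`, then the divergence is known up to a factor `exp (± ε)`. -/
lemma estimate_mem_of_abs_sub_le (ν μ : IsingModel G) (α : ℕ) {ε e a₀ a₁ T : ℝ} (hε : 0 < ε)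
    (hε1 : ε < 1)
    (h0 : |a₀ - ∑ σ, μ.gibbs σ * psi α (ratio ν μ σ)| ≤ e)
    (h1 : |a₁ - ∑ σ, (ν.interp μ α).gibbs σ * psi α (ratio ν μ σ)| ≤ e)
    (hT : |T - moment ν μ α| ≤ ε / 4 * moment ν μ α)
    (he : e * (1 + 2 * moment ν μ α) ≤ ε / 4 * (2 * chiDivergence α ν.gibbs μ.gibbs)) :
    Real.exp (-ε) * chiDivergence α ν.gibbs μ.gibbs ≤ (a₀ + T * a₁) / 2 ∧
      (a₀ + T * a₁) / 2 ≤ Real.exp ε * chiDivergence α ν.gibbs μ.gibbs := by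
  have hD := two_mul_chiDivergence_eq_psi ν μ α
  set D := chiDivergence α ν.gibbs μ.gibbs
  set p₀ := ∑ σ, μ.gibbs σ * psi α (ratio ν μ σ)
  set p₁ := ∑ σ, (ν.interp μ α).gibbs σ * psi α (ratio ν μ σ)
  set R := moment ν μ α
  have hR : 0 < R := moment_pos ν μ α
  have hp₀ : 0 ≤ p₀ := Finset.sum_nonneg fun σ _ =>
    mul_nonneg (gibbs_pos _ σ).le (psi_nonneg α (ratio_pos ν μ σ).le)
  have hp₁ : 0 ≤ p₁ := Finset.sum_nonneg fun σ _ =>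
    mul_nonneg (gibbs_pos _ σ).le (psi_nonneg α (ratio_pos ν μ σ).le)
  have he0 : 0 ≤ e := (abs_nonneg _).trans h0
  have hD0 : 0 ≤ D := by nlinarith [mul_nonneg hR.le hp₁]
  have hTabs : |T| ≤ 2 * R := by
    have h2 := abs_add_le (T - R) R
    rw [sub_add_cancel, abs_of_pos hR] at h2
    nlinarith
  have key : |(a₀ + T * a₁) - 2 * D| ≤ ε / 2 * (2 * D) := by
    have hid : (a₀ + T * a₁) - 2 * D = (a₀ - p₀) + (T * (a₁ - p₁) + (T - R) * p₁) := by
      rw [hD]; ring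
    have h2 := abs_add_le (a₀ - p₀) (T * (a₁ - p₁) + (T - R) * p₁)
    have h3 := abs_add_le (T * (a₁ - p₁)) ((T - R) * p₁)
    have h4 : |T * (a₁ - p₁)| ≤ 2 * R * e := by
      rw [abs_mul]; exact mul_le_mul hTabs h1 (abs_nonneg _) (by positivity)
    have h5 : |(T - R) * p₁| ≤ ε / 4 * R * p₁ := by
      rw [abs_mul, abs_of_nonneg hp₁]; exact mul_le_mul_of_nonneg_right hT hp₁
    rw [hid]
    nlinarith [mul_nonneg hε.le hp₀]
  rw [abs_le] at key
  -- `ε < 1` turns the additive bounds `1 ± ε / 2` into the factors `exp (± ε)`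
  have h6 : Real.exp (-ε) ≤ 1 - ε / 2 := by
    have := Real.add_one_le_exp ε
    rw [Real.exp_neg, inv_le_comm₀ (Real.exp_pos _) (by linarith)]
    refine le_trans ?_ this
    rw [inv_eq_one_div, div_le_iff₀ (by linarith)]
    nlinarith
  have h7 := Real.add_one_le_exp ε
  constructor
  · nlinarith [mul_le_mul_of_nonneg_right h6 hD0]
  · nlinarith [mul_le_mul_of_nonneg_right h7 hD0, mul_nonneg hε.le hD0]

/-- A natural number `K` such that errors of the order of `ε / K` in the algorithm are harmless: the
factor `(6 / b ^ 4) ^ α + 1` comes from comparing the parameters and the moment with the divergence,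
the other factors from the modulus of continuity of the integrand and from numerical constants. -/
noncomputable def scale (α : ℕ) (b : ℝ) : ℕ :=
  ⌈2048 * α * 64 ^ α * ((6 * b⁻¹ ^ 4) ^ α + 1)⌉₊

lemma le_scale (α : ℕ) (b : ℝ) :
    2048 * α * 64 ^ α * ((6 * b⁻¹ ^ 4) ^ α + 1) ≤ (scale α b : ℝ) := Nat.le_ceil _

lemma mul_le_scale {α : ℕ} {b : ℝ} (hb : 0 < b) : 2048 * α * 64 ^ α ≤ (scale α b : ℝ) := by
  refine le_trans ?_ (le_scale α b)
  refine le_mul_of_one_le_right (by positivity) ?_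
  have : 0 ≤ (6 * b⁻¹ ^ 4) ^ α := by positivity
  linarith

lemma scale_pos {α : ℕ} (hα : 1 ≤ α) {b : ℝ} (hb : 0 < b) : 0 < scale α b := by
  have hα' : (0 : ℝ) < α := by exact_mod_cast hα
  have h := mul_le_scale (α := α) hb
  have : (0 : ℝ) < scale α b := lt_of_lt_of_le (by positivity) h
  exact_mod_cast this

/-- The divergence is at least of the order of `(min L 1 / N) ^ α`, where `L` is the distance of
the parameters and `N = n + m`. Hence additive errors of the order of `ε (min L 1 / N) ^ α` are
harmless. -/
lemma error_le {ν μ : IsingModel G} {b : ℝ} (hb : 0 < b) (hb1 : b < 1)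
    (hν : ν.MarginallyBounded b) (hμ : μ.MarginallyBounded b) (E : EdgeList G m) {α : ℕ}
    (hα : 1 ≤ α) {ε N : ℝ} (hε : 0 < ε) (hN : N = Fintype.card V + m) (hN1 : 1 ≤ N) :
    (128 * α * 32 ^ α * (ε / scale α b) * (min (paramDist ν μ E) 1 / N) ^ α) *
      (1 + 2 * moment ν μ α) ≤ ε / 4 * (2 * chiDivergence α ν.gibbs μ.gibbs) := by
  have hL := paramDist_le hb hb1 hν hμ E
  have hL0 := paramDist_nonneg ν μ E
  have hA := gibbsDist_pow_le ν μ α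
  have hA0 := gibbsDist_nonneg ν μ
  have hT := moment_le ν μ α
  have hK := le_scale α b
  have hKpos : (0 : ℝ) < scale α b := by exact_mod_cast scale_pos hα hb
  rw [← hN] at hL
  set D := 2 * chiDivergence α ν.gibbs μ.gibbs
  set c := (6 * b⁻¹ ^ 4) ^ α with hc
  have hc0 : 0 ≤ c := by positivity
  have hD0 : 0 ≤ D := (pow_nonneg hA0 α).trans hA
  set q := min (paramDist ν μ E) 1 / N with hq
  have hN0 : 0 < N := by linarith
  have hq0 : 0 ≤ q := div_nonneg (le_min hL0 zero_le_one) hN0.le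
  have hq1 : q ^ α ≤ 1 := pow_le_one₀ hq0 ((div_le_one hN0).2 ((min_le_right _ _).trans hN1))
  have hq2 : q ^ α ≤ c * D := by
    have h1 : q ≤ 6 * b⁻¹ ^ 4 * gibbsDist ν μ := by
      rw [hq, div_le_iff₀ hN0]
      calc _ ≤ paramDist ν μ E := min_le_left _ _
        _ ≤ _ := hL
        _ = _ := by ring
    calc q ^ α ≤ (6 * b⁻¹ ^ 4 * gibbsDist ν μ) ^ α := pow_le_pow_left₀ hq0 h1 α
      _ = c * gibbsDist ν μ ^ α := mul_pow _ _ _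
      _ ≤ c * D := by gcongr
  have hqα : 0 ≤ q ^ α := pow_nonneg hq0 α
  have h2α : (1 : ℝ) ≤ 2 ^ α := one_le_pow₀ (by norm_num)
  have h3 : q ^ α * (1 + 2 * moment ν μ α) ≤ 4 * 2 ^ α * ((c + 1) * D) := by
    calc _ ≤ q ^ α * (4 * 2 ^ α * (1 + D)) := by
          refine mul_le_mul_of_nonneg_left ?_ hqα
          nlinarith [mul_nonneg (by positivity : (0 : ℝ) ≤ 2 ^ α) hD0]
      _ = 4 * 2 ^ α * (q ^ α + q ^ α * D) := by ring
      _ ≤ 4 * 2 ^ α * (c * D + 1 * D) := by gcongr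
      _ = _ := by ring
  have h4 : 128 * α * 32 ^ α * (4 * 2 ^ α * (c + 1)) ≤ (scale α b : ℝ) / 4 := by
    have : (64 : ℝ) ^ α = 32 ^ α * 2 ^ α := by rw [← mul_pow]; norm_num
    rw [this] at hK
    linarith
  calc _ = 128 * α * 32 ^ α * (ε / scale α b) * (q ^ α * (1 + 2 * moment ν μ α)) := by ring
    _ ≤ 128 * α * 32 ^ α * (ε / scale α b) * (4 * 2 ^ α * ((c + 1) * D)) := by gcongr
    _ = (128 * α * 32 ^ α * (4 * 2 ^ α * (c + 1))) * (ε / scale α b) * D := by ring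
    _ ≤ (scale α b / 4) * (ε / scale α b) * D := by gcongr
    _ = _ := by field_simp

/-- The error of a mean of the integrand due to the approximate ratio of partition functions. -/
lemma abs_psi_exp_mul_sub_le (ν μ : IsingModel G) (E : EdgeList G m) {α : ℕ} (hα : 1 ≤ α)
    {θ s : ℝ} (hs0 : 0 ≤ s) (hs : 24 * α * 2 ^ α * s ≤ 1)
    (hθ : |θ / (μ.Z / ν.Z) - 1| ≤ 12 * s * min (paramDist ν μ E) 1) (σ : V → Spin) :
    |psi α (Real.exp (logRatio ν μ σ) * θ) - psi α (ratio ν μ σ)| ≤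
      48 * α * 32 ^ α * s * min (paramDist ν μ E) 1 ^ α := by
  set lam := min (paramDist ν μ E) 1 with hlam
  have hlam0 : 0 ≤ lam := le_min (paramDist_nonneg ν μ E) zero_le_one
  have hlam1 : lam ≤ 1 := min_le_right _ _
  have hα' : (1 : ℝ) ≤ α := by exact_mod_cast hα
  have h2α : (1 : ℝ) ≤ 2 ^ α := one_le_pow₀ (by norm_num)
  have hα2 : (1 : ℝ) ≤ α * 2 ^ α := by nlinarith
  have hs1 : 24 * s ≤ 1 := by nlinarith
  have h := abs_psi_sub_psi_le hα (ratio_pos ν μ σ).le hlam0 hlam1 (abs_ratio_sub_one_le ν μ E σ)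
    hθ (by nlinarith) (by
      calc _ = (24 * α * 2 ^ α * s) * lam / 2 := by ring
        _ ≤ 1 * 1 / 2 := by gcongr
        _ = _ := by norm_num)
  have hμ := μ.Z_pos
  have hν := ν.Z_pos
  have hid : ratio ν μ σ * (1 + (θ / (μ.Z / ν.Z) - 1)) = Real.exp (logRatio ν μ σ) * θ := by
    rw [ratio]; field_simp; ring
  rw [hid] at h
  refine h.trans (le_of_eq ?_)
  obtain ⟨k, rfl⟩ : ∃ k, α = k + 1 := ⟨α - 1, by omega⟩
  simp only [Nat.add_sub_cancel]
  ring

end IsingModel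

/-! ### Reasoning about programs -/

section
variable {α n : ℕ} {Ω : Type*} {O : Oracles α n Ω} {ω : ℕ → Ω}

/-- Started in state `s`, the program `p` halts within time `T`, in a state that satisfies `Q`. -/
def Halts (O : Oracles α n Ω) (ω : ℕ → Ω) (p : Program α) (s : State) (T : ℝ)
    (Q : State → Prop) : Prop :=
  ∃ s' t, Exec O ω p s s' t ∧ t ≤ T ∧ Q s'

lemma Halts.mono {p : Program α} {s : State} {T T' : ℝ} {Q Q' : State → Prop}
    (h : Halts O ω p s T Q) (hT : T ≤ T') (hQ : ∀ s', Q s' → Q' s') : Halts O ω p s T' Q' := by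
  obtain ⟨s', t, h1, h2, h3⟩ := h
  exact ⟨s', t, h1, h2.trans hT, hQ s' h3⟩

lemma Halts.setNat {a : ℕ} {i e : NatExpr} {s : State} {T : ℝ} {Q : State → Prop}
    (hT : (i.cost : ℝ) + e.cost + 1 ≤ T) (h : Q (s.setNat a (i.eval s) (e.eval s))) :
    Halts O ω (.setNat a i e) s T Q :=
  ⟨_, _, .setNat a i e s, hT, h⟩

lemma Halts.setReal {a : ℕ} {i : NatExpr} {e : RealExpr} {s : State} {T : ℝ} {Q : State → Prop}
    (hT : (i.cost : ℝ) + e.cost + 1 ≤ T) (h : Q (s.setReal a (i.eval s) (e.eval s))) :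
    Halts O ω (.setReal a i e) s T Q :=
  ⟨_, _, .setReal a i e s, hT, h⟩

lemma Halts.seq {p q : Program α} {s : State} {T T' : ℝ} {Q : State → Prop}
    (h : Halts O ω p s T fun s' => Halts O ω q s' T' Q) : Halts O ω (.seq p q) s (T + T') Q := by
  obtain ⟨s', t, h1, h2, s'', t', h3, h4, h5⟩ := h
  exact ⟨s'', _, .seq h1 h3, add_le_add h2 h4, h5⟩

lemma Halts.branch {c : Test} {p q : Program α} {s : State} {T : ℝ} {Q : State → Prop}
    (h1 : c.holds s → Halts O ω p s T Q) (h2 : ¬ c.holds s → Halts O ω q s T Q) :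
    Halts O ω (.branch c p q) s (c.cost + T) Q := by
  by_cases hc : c.holds s
  · obtain ⟨s', t, h3, h4, h5⟩ := h1 hc
    exact ⟨s', _, .branchTrue hc h3, by linarith, h5⟩
  · obtain ⟨s', t, h3, h4, h5⟩ := h2 hc
    exact ⟨s', _, .branchFalse hc h3, by linarith, h5⟩

/-- A loop whose test holds for exactly `M` rounds. -/
lemma Halts.loop {c : Test} {p : Program α} {T : ℝ} {M : ℕ} (I : ℕ → State → Prop)
    (hI : ∀ i s, I i s → (c.holds s ↔ i < M))
    (hp : ∀ i < M, ∀ s, I i s → Halts O ω p s T (I (i + 1))) {s : State} (h0 : I 0 s) :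
    Halts O ω (.loop c p) s (M * (c.cost + T) + c.cost) (I M) := by
  have key : ∀ k i s, i + k = M → I i s →
      Halts O ω (.loop c p) s (k * (c.cost + T) + c.cost) (I M) := by
    intro k
    induction k with
    | zero =>
      intro i s hi hs
      have hiM : i = M := by omega
      subst hiM
      exact ⟨s, _, .loopFalse (by simp [hI i s hs]), by simp, hs⟩
    | succ k ih =>
      intro i s hi hs
      obtain ⟨s', t, h1, h2, h3⟩ := hp i (by omega) s hs
      obtain ⟨s'', t', h4, h5, h6⟩ := ih (i + 1) s' (by omega) h3
      refine ⟨s'', _, .loopTrue ((hI i s hs).2 (by omega)) h1 h4, ?_, h6⟩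
      push_cast
      linarith
  exact key M 0 s (by omega) h0

lemma Halts.sample {k : Fin (α + 1)} {acc : RealExpr} {a : ℕ} {s : State} {T : ℝ}
    {Q : State → Prop} (hacc : 0 < acc.eval s)
    (hT : (acc.cost : ℝ) + O.sampleCost (acc.eval s) + 1 ≤ T)
    (h : Q (s.setVec a (spinVec (O.sample k (acc.eval s) (ω s.calls)))).tick) :
    Halts O ω (.sample k acc a) s T Q :=
  ⟨_, _, .sample k acc a s hacc, hT, h⟩

lemma Halts.count {k : Fin (α + 1)} {acc : RealExpr} {a : ℕ} {i : NatExpr} {s : State} {T : ℝ}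
    {Q : State → Prop} (hacc : 0 < acc.eval s)
    (hT : (acc.cost : ℝ) + i.cost + O.countCost (acc.eval s) + 1 ≤ T)
    (h : Q (s.setReal a (i.eval s) (O.count k (acc.eval s) (ω s.calls))).tick) :
    Halts O ω (.count k acc a i) s T Q :=
  ⟨_, _, .count k acc a i s hacc, hT, h⟩

end

/-- The `k`-th power of an expression. -/
def RealExpr.pow (e : RealExpr) : ℕ → RealExpr
  | 0 => .ofNat (.const 1)
  | k + 1 => .mul (e.pow k) e

lemma RealExpr.eval_pow (e : RealExpr) (s : State) (k : ℕ) :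
    (e.pow k).eval s = e.eval s ^ k := by
  induction k with
  | zero => simp [RealExpr.pow, RealExpr.eval, NatExpr.eval]
  | succ k ih => simp [RealExpr.pow, RealExpr.eval, ih, pow_succ]

/-- The entry `i` of the natural array `a`. -/
abbrev natCell (a i : ℕ) : NatExpr := .read a (.const i)

/-- The entry `i` of the real array `a`. -/
abbrev realCell (a i : ℕ) : RealExpr := .read a (.const i)

/-! ### Sums over the edges and the vertices -/

/-- Two memories that agree apart from the counter of an inner loop (entry 0 of the natural array
3) and the registers of an inner loop (entries 0 and 1 of the real array 7). -/
structure InnerFrame (s s' : State) : Prop where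
  calls : s'.calls = s.calls
  nat : ∀ a i, ¬ (a = 3 ∧ i = 0) → s'.nat a i = s.nat a i
  real : ∀ a i, ¬ (a = 7 ∧ i < 2) → s'.real a i = s.real a i

lemma InnerFrame.trans {s s' s'' : State} (h : InnerFrame s s') (h' : InnerFrame s' s'') :
    InnerFrame s s'' :=
  ⟨h'.calls.trans h.calls, fun a i hi => (h'.nat a i hi).trans (h.nat a i hi),
    fun a i hi => (h'.real a i hi).trans (h.real a i hi)⟩

lemma InnerFrame.setNat (s : State) (x : ℕ) : InnerFrame s (s.setNat 3 0 x) :=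
  ⟨rfl, fun a i hi => by simp [State.setNat, hi], fun _ _ _ => rfl⟩

lemma InnerFrame.setReal (s : State) {j : ℕ} (hj : j < 2) (x : ℝ) :
    InnerFrame s (s.setReal 7 j x) :=
  ⟨rfl, fun _ _ _ => rfl, fun a i hi => by
    simp only [State.setReal]
    rw [if_neg]
    rintro ⟨rfl, rfl⟩
    exact hi ⟨rfl, hj⟩⟩

/-- Run `p` with the inner counter at `0, …, K - 1`, where `K` is the entry `j` of the natural
array 0. -/
def sumLoop {α : ℕ} (j : ℕ) (p : Program α) : Program α :=
  .seq (.setNat 3 (.const 0) (.const 0))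
    (.loop (.natLt (natCell 3 0) (natCell 0 j))
      (.seq p (.setNat 3 (.const 0) (.add (natCell 3 0) (.const 1)))))

section
variable {α n : ℕ} {Ω : Type*} {O : Oracles α n Ω} {ω : ℕ → Ω}

lemma halts_sumLoop {j K : ℕ} {p : Program α} {T : ℝ} {g : ℕ → ℝ} {s₀ : State}
    (hK : s₀.nat 0 j = K)
    (hp : ∀ i < K, ∀ s, InnerFrame s₀ s → s.nat 3 0 = i → Halts O ω p s T fun s' =>
      InnerFrame s s' ∧ s'.nat 3 0 = i ∧ s'.real 7 0 = s.real 7 0 + g i) :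
    Halts O ω (sumLoop j p) s₀ (K * (T + 11) + 8) fun s' =>
      InnerFrame s₀ s' ∧ s'.real 7 0 = s₀.real 7 0 + ∑ i ∈ Finset.range K, g i := by
  have hmain : Halts O ω (sumLoop j p) s₀ (3 + (K * (5 + (T + 6)) + 5)) fun s' =>
      InnerFrame s₀ s' ∧ s'.nat 3 0 = K ∧
        s'.real 7 0 = s₀.real 7 0 + ∑ i ∈ Finset.range K, g i := by
    refine Halts.seq (Halts.setNat (by norm_num [NatExpr.cost]) ?_)
    have h := Halts.loop (O := O) (ω := ω) (c := .natLt (natCell 3 0) (natCell 0 j))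
      (p := .seq p (.setNat 3 (.const 0) (.add (natCell 3 0) (.const 1)))) (T := T + 6) (M := K)
      (fun i s => InnerFrame s₀ s ∧ s.nat 3 0 = i ∧
        s.real 7 0 = s₀.real 7 0 + ∑ k ∈ Finset.range i, g k)
      (s := s₀.setNat 3 ((NatExpr.const 0).eval s₀) ((NatExpr.const 0).eval s₀)) ?_ ?_ ?_
    · refine h.mono ?_ fun _ h => h
      norm_num [Test.cost, NatExpr.cost]
    · rintro i s ⟨h1, h2, -⟩
      simp [Test.holds, NatExpr.eval, h2, h1.nat 0 j (by simp), hK]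
    · rintro i hi s ⟨h1, h2, h3⟩
      refine Halts.seq ((hp i hi s h1 h2).mono le_rfl ?_)
      rintro s' ⟨h4, h5, h6⟩
      refine Halts.setNat (by norm_num [NatExpr.cost]) ⟨?_, ?_, ?_⟩
      · exact (h1.trans h4).trans (InnerFrame.setNat _ _)
      · simp [State.setNat, NatExpr.eval, h5]
      · simp [State.setNat, h6, h3, Finset.sum_range_succ, add_assoc]
    · exact ⟨InnerFrame.setNat _ _, by simp [State.setNat, NatExpr.eval], by simp [State.setNat]⟩
  exact hmain.mono (by linarith) fun s' h => ⟨h.1, h.2.2⟩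

end

/-- The input is in its place in the memory. -/
structure HasInput {n m : ℕ} {G : SimpleGraph (Fin n)} (E : EdgeList G m) (ν μ : IsingModel G)
    (s : State) : Prop where
  card : s.nat 0 0 = n
  edges : s.nat 0 1 = m
  src : ∀ i : Fin m, s.nat 1 i = E.src i
  dst : ∀ i : Fin m, s.nat 2 i = E.dst i
  Jν : ∀ i : Fin m, s.real 1 i = ν.J (E.src i) (E.dst i)
  Jμ : ∀ i : Fin m, s.real 2 i = μ.J (E.src i) (E.dst i)
  hν : ∀ v : Fin n, s.real 3 v = ν.h v
  hμ : ∀ v : Fin n, s.real 4 v = μ.h v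

/-- Two memories that agree apart from counters (the natural array 3), the sample (the real array
5) and temporary registers (the real array 7). -/
structure OuterFrame (s s' : State) : Prop where
  nat : ∀ a i, a ≠ 3 → s'.nat a i = s.nat a i
  real : ∀ a i, a ≠ 5 → a ≠ 7 → s'.real a i = s.real a i

lemma OuterFrame.trans {s s' s'' : State} (h : OuterFrame s s') (h' : OuterFrame s' s'') :
    OuterFrame s s'' :=
  ⟨fun a i hi => (h'.nat a i hi).trans (h.nat a i hi),
    fun a i h5 h7 => (h'.real a i h5 h7).trans (h.real a i h5 h7)⟩

lemma InnerFrame.outer {s s' : State} (h : InnerFrame s s') : OuterFrame s s' :=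
  ⟨fun a i hi => h.nat a i fun h => hi h.1, fun a i _ h7 => h.real a i fun h => h7 h.1⟩

lemma OuterFrame.setNat (s : State) (i x : ℕ) : OuterFrame s (s.setNat 3 i x) :=
  ⟨fun a i hi => by simp [State.setNat, hi], fun _ _ _ _ => rfl⟩

lemma OuterFrame.setReal (s : State) (i : ℕ) (x : ℝ) : OuterFrame s (s.setReal 7 i x) :=
  ⟨fun _ _ _ => rfl, fun a i _ h7 => by simp [State.setReal, h7]⟩

lemma OuterFrame.setVec_tick (s : State) {n : ℕ} (x : Fin n → ℝ) :
    OuterFrame s (s.setVec 5 x).tick :=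
  ⟨fun _ _ _ => rfl, fun a i h5 _ => by simp [State.setVec, State.tick, h5]⟩

section
variable {n m : ℕ} {G : SimpleGraph (Fin n)} {E : EdgeList G m} {ν μ : IsingModel G}

lemma HasInput.of_eq {s s' : State} (h : HasInput E ν μ s)
    (hnat : ∀ a i, a < 3 → s'.nat a i = s.nat a i)
    (hreal : ∀ a i, 0 < a → a < 5 → s'.real a i = s.real a i) : HasInput E ν μ s' where
  card := by rw [hnat _ _ (by norm_num), h.card]
  edges := by rw [hnat _ _ (by norm_num), h.edges]
  src i := by rw [hnat _ _ (by norm_num), h.src]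
  dst i := by rw [hnat _ _ (by norm_num), h.dst]
  Jν i := by rw [hreal _ _ (by norm_num) (by norm_num), h.Jν]
  Jμ i := by rw [hreal _ _ (by norm_num) (by norm_num), h.Jμ]
  hν i := by rw [hreal _ _ (by norm_num) (by norm_num), h.hν]
  hμ i := by rw [hreal _ _ (by norm_num) (by norm_num), h.hμ]

lemma HasInput.outer {s s' : State} (h : HasInput E ν μ s) (h' : OuterFrame s s') :
    HasInput E ν μ s' :=
  h.of_eq (fun a i ha => h'.nat a i (by omega)) fun a i _ ha => h'.real a i (by omega) (by omega)

lemma HasInput.setReal {s : State} (h : HasInput E ν μ s) {a : ℕ} (ha : 4 < a) (i : ℕ) (x : ℝ) :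
    HasInput E ν μ (s.setReal a i x) :=
  h.of_eq (fun _ _ _ => rfl) fun a' i' _ ha' => by
    simp only [State.setReal]
    rw [if_neg]
    omega

lemma HasInput.tick {s : State} (h : HasInput E ν μ s) : HasInput E ν μ s.tick :=
  h.of_eq (fun _ _ _ => rfl) fun _ _ _ _ => rfl

lemma hasInput_inputState (ε : ℝ) : HasInput E ν μ (inputState E ν μ ε) where
  card := by simp [inputState, padded]
  edges := by simp [inputState, padded]
  src i := by simp [inputState, padded]
  dst i := by simp [inputState, padded]
  Jν i := by simp [inputState, padded]
  Jμ i := by simp [inputState, padded]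
  hν i := by simp [inputState, padded]
  hμ i := by simp [inputState, padded]

lemma sum_range_padded (x : Fin n → ℝ) : ∑ i ∈ Finset.range n, padded x i = ∑ i, x i := by
  rw [Finset.sum_range]
  simp [padded]

/-- The inner counter. -/
abbrev counter : NatExpr := natCell 3 0

/-- The contribution of an edge to `logRatio` at the configuration in the real array 5. -/
def edgeTerm : RealExpr :=
  .mul (.mul (.sub (.read 1 counter) (.read 2 counter)) (.read 5 (.read 1 counter)))
    (.read 5 (.read 2 counter))

/-- The contribution of a vertex to `logRatio`. -/
def vertexTerm : RealExpr :=
  .mul (.sub (.read 3 counter) (.read 4 counter)) (.read 5 counter)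

/-- Add an expression to the inner register 0. -/
def addTerm {α : ℕ} (e : RealExpr) : Program α :=
  .setReal 7 (.const 0) (.add (realCell 7 0) e)

/-- Add the absolute value of an expression to the inner register 0. -/
def addAbs {α : ℕ} (e : RealExpr) : Program α :=
  .seq (.setReal 7 (.const 1) e)
    (.branch (.realLt (realCell 7 1) (.ofNat (.const 0)))
      (.setReal 7 (.const 0) (.sub (realCell 7 0) (realCell 7 1)))
      (.setReal 7 (.const 0) (.add (realCell 7 0) (realCell 7 1))))

/-- Compute `logRatio` at the configuration in the real array 5. -/
def logRatioProgram {α : ℕ} : Program α :=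
  .seq (.setReal 7 (.const 0) (.ofNat (.const 0)))
    (.seq (sumLoop 1 (addTerm edgeTerm)) (sumLoop 0 (addTerm vertexTerm)))

/-- Compute `paramDist`. -/
def paramDistProgram {α : ℕ} : Program α :=
  .seq (.setReal 7 (.const 0) (.ofNat (.const 0)))
    (.seq (sumLoop 1 (addAbs (.sub (.read 1 counter) (.read 2 counter))))
      (sumLoop 0 (addAbs (.sub (.read 3 counter) (.read 4 counter)))))

variable {α : ℕ} {Ω : Type*} {O : Oracles α n Ω} {ω : ℕ → Ω}

lemma halts_addTerm {e : RealExpr} {s : State} {i : ℕ} {x : ℝ} (hi : s.nat 3 0 = i)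
    (hx : e.eval s = x) : Halts O ω (addTerm e) s (e.cost + 5) fun s' =>
      InnerFrame s s' ∧ s'.nat 3 0 = i ∧ s'.real 7 0 = s.real 7 0 + x := by
  refine Halts.setReal ?_ ⟨InnerFrame.setReal _ (by norm_num [NatExpr.eval]) _, hi, ?_⟩
  · push_cast [RealExpr.cost, NatExpr.cost]; linarith
  · simp [State.setReal, RealExpr.eval, NatExpr.eval, hx]

lemma halts_addAbs {e : RealExpr} {s : State} {i : ℕ} {x : ℝ} (hi : s.nat 3 0 = i)
    (hx : e.eval s = x) : Halts O ω (addAbs e) s (e.cost + 14) fun s' =>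
      InnerFrame s s' ∧ s'.nat 3 0 = i ∧ s'.real 7 0 = s.real 7 0 + |x| := by
  have h : Halts O ω (addAbs e) s ((e.cost + 2) + (5 + 7)) fun s' =>
      InnerFrame s s' ∧ s'.nat 3 0 = i ∧ s'.real 7 0 = s.real 7 0 + |x| := by
    refine Halts.seq (Halts.setReal ?_ ?_)
    · push_cast [NatExpr.cost]; linarith
    have hfr : InnerFrame s (s.setReal 7 ((NatExpr.const 1).eval s) (e.eval s)) :=
      InnerFrame.setReal _ (by norm_num [NatExpr.eval]) _
    refine (Halts.branch (T := 7) (fun hc => ?_) fun hc => ?_).mono ?_ fun _ h => h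
    · refine Halts.setReal ?_ ⟨hfr.trans (InnerFrame.setReal _ (by norm_num [NatExpr.eval]) _),
        hi, ?_⟩
      · norm_num [NatExpr.cost, RealExpr.cost]
      · simp [Test.holds, State.setReal, RealExpr.eval, NatExpr.eval, hx] at hc ⊢
        rw [abs_of_neg hc]; ring
    · refine Halts.setReal ?_ ⟨hfr.trans (InnerFrame.setReal _ (by norm_num [NatExpr.eval]) _),
        hi, ?_⟩
      · norm_num [NatExpr.cost, RealExpr.cost]
      · simp [Test.holds, State.setReal, RealExpr.eval, NatExpr.eval, hx] at hc ⊢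
        rw [abs_of_nonneg hc]
    · norm_num [Test.cost, NatExpr.cost, RealExpr.cost]
  exact h.mono (by linarith) fun _ h => h

lemma halts_logRatioProgram {s : State} (hs : HasInput E ν μ s) {σ : Fin n → Spin}
    (hσ : ∀ v : Fin n, s.real 5 v = spinVec σ v) :
    Halts O ω (logRatioProgram (α := α)) s (40 * (n + m) + 20) fun s' =>
      InnerFrame s s' ∧ s'.real 7 0 = IsingModel.logRatio ν μ σ := by
  have h : Halts O ω (logRatioProgram (α := α)) s
      (4 + ((m * ((20 + 5) + 11) + 8) + (n * ((12 + 5) + 11) + 8))) fun s' =>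
      InnerFrame s s' ∧ s'.real 7 0 = IsingModel.logRatio ν μ σ := by
    refine Halts.seq (Halts.setReal (by norm_num [NatExpr.cost, RealExpr.cost]) ?_)
    set s₁ := s.setReal 7 ((NatExpr.const 0).eval s) ((RealExpr.ofNat (.const 0)).eval s) with hs₁
    have f₁ : InnerFrame s s₁ := InnerFrame.setReal _ (by norm_num [NatExpr.eval]) _
    have z₁ : s₁.real 7 0 = 0 := by simp [hs₁, State.setReal, RealExpr.eval, NatExpr.eval]
    refine Halts.seq ((halts_sumLoop (K := m) (g := padded fun i : Fin m =>
      (ν.J (E.src i) (E.dst i) - μ.J (E.src i) (E.dst i)) * spinVec σ (E.src i) *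
        spinVec σ (E.dst i)) ?_ ?_).mono le_rfl ?_)
    · rw [f₁.nat _ _ (by norm_num), hs.edges]
    · intro i hi s₂ f₂ hc
      have f := f₁.trans f₂
      have hs₂ := hs.outer f.outer
      have hσ₂ : ∀ v : Fin n, s₂.real 5 v = spinVec σ v := fun v => by
        rw [f.real _ _ (by norm_num), hσ]
      refine (halts_addTerm hc ?_).mono (by norm_num [edgeTerm, RealExpr.cost, NatExpr.cost])
        fun _ h => h
      have h1 := hs₂.src ⟨i, hi⟩
      have h2 := hs₂.dst ⟨i, hi⟩
      have h3 := hs₂.Jν ⟨i, hi⟩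
      have h4 := hs₂.Jμ ⟨i, hi⟩
      simp only at h1 h2 h3 h4
      simp [edgeTerm, RealExpr.eval, NatExpr.eval, hc, h1, h2, h3, h4, hσ₂, padded, hi]
    rintro s₃ ⟨f₃, z₃⟩
    refine (halts_sumLoop (K := n) (g := padded fun v : Fin n =>
      (ν.h v - μ.h v) * spinVec σ v) ?_ ?_).mono le_rfl ?_
    · rw [(f₁.trans f₃).nat _ _ (by norm_num), hs.card]
    · intro i hi s₂ f₂ hc
      have f := (f₁.trans f₃).trans f₂
      have hs₂ := hs.outer f.outer
      have hσ₂ : ∀ v : Fin n, s₂.real 5 v = spinVec σ v := fun v => by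
        rw [f.real _ _ (by norm_num), hσ]
      refine (halts_addTerm hc ?_).mono (by norm_num [vertexTerm, RealExpr.cost, NatExpr.cost])
        fun _ h => h
      have h3 := hs₂.hν ⟨i, hi⟩
      have h4 := hs₂.hμ ⟨i, hi⟩
      have h5 := hσ₂ ⟨i, hi⟩
      simp only at h3 h4 h5
      simp [vertexTerm, RealExpr.eval, NatExpr.eval, hc, h3, h4, h5, padded, hi]
    · rintro s₄ ⟨f₄, z₄⟩
      refine ⟨(f₁.trans f₃).trans f₄, ?_⟩
      rw [z₄, z₃, z₁, sum_range_padded, sum_range_padded, IsingModel.logRatio_eq_sum_edges ν μ E,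
        zero_add]
  refine h.mono ?_ fun _ h => h
  have : (0 : ℝ) ≤ n := n.cast_nonneg
  have : (0 : ℝ) ≤ m := m.cast_nonneg
  linarith

lemma halts_paramDistProgram {s : State} (hs : HasInput E ν μ s) :
    Halts O ω (paramDistProgram (α := α)) s (40 * (n + m) + 20) fun s' =>
      InnerFrame s s' ∧ s'.real 7 0 = IsingModel.paramDist ν μ E := by
  have h : Halts O ω (paramDistProgram (α := α)) s
      (4 + ((m * ((7 + 14) + 11) + 8) + (n * ((7 + 14) + 11) + 8))) fun s' =>
      InnerFrame s s' ∧ s'.real 7 0 = IsingModel.paramDist ν μ E := by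
    refine Halts.seq (Halts.setReal (by norm_num [NatExpr.cost, RealExpr.cost]) ?_)
    set s₁ := s.setReal 7 ((NatExpr.const 0).eval s) ((RealExpr.ofNat (.const 0)).eval s) with hs₁
    have f₁ : InnerFrame s s₁ := InnerFrame.setReal _ (by norm_num [NatExpr.eval]) _
    have z₁ : s₁.real 7 0 = 0 := by simp [hs₁, State.setReal, RealExpr.eval, NatExpr.eval]
    refine Halts.seq ((halts_sumLoop (K := m) (g := padded fun i : Fin m =>
      |ν.J (E.src i) (E.dst i) - μ.J (E.src i) (E.dst i)|) ?_ ?_).mono le_rfl ?_)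
    · rw [f₁.nat _ _ (by norm_num), hs.edges]
    · intro i hi s₂ f₂ hc
      have hs₂ := hs.outer (f₁.trans f₂).outer
      have h3 := hs₂.Jν ⟨i, hi⟩
      have h4 := hs₂.Jμ ⟨i, hi⟩
      simp only at h3 h4
      rw [show padded (fun i : Fin m => |ν.J (E.src i) (E.dst i) - μ.J (E.src i) (E.dst i)|) i =
        |ν.J (E.src ⟨i, hi⟩) (E.dst ⟨i, hi⟩) - μ.J (E.src ⟨i, hi⟩) (E.dst ⟨i, hi⟩)| by
          simp [padded, hi]]
      refine (halts_addAbs hc ?_).mono (by norm_num [RealExpr.cost, NatExpr.cost]) fun _ h => h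
      simp [RealExpr.eval, NatExpr.eval, hc, h3, h4]
    rintro s₃ ⟨f₃, z₃⟩
    refine (halts_sumLoop (K := n) (g := padded fun v : Fin n => |ν.h v - μ.h v|) ?_ ?_).mono
      le_rfl ?_
    · rw [(f₁.trans f₃).nat _ _ (by norm_num), hs.card]
    · intro i hi s₂ f₂ hc
      have hs₂ := hs.outer ((f₁.trans f₃).trans f₂).outer
      have h3 := hs₂.hν ⟨i, hi⟩
      have h4 := hs₂.hμ ⟨i, hi⟩
      simp only at h3 h4
      rw [show padded (fun v : Fin n => |ν.h v - μ.h v|) i = |ν.h ⟨i, hi⟩ - μ.h ⟨i, hi⟩| by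
        simp [padded, hi]]
      refine (halts_addAbs hc ?_).mono (by norm_num [RealExpr.cost, NatExpr.cost]) fun _ h => h
      simp [RealExpr.eval, NatExpr.eval, hc, h3, h4]
    · rintro s₄ ⟨f₄, z₄⟩
      refine ⟨(f₁.trans f₃).trans f₄, ?_⟩
      rw [z₄, z₃, z₁, sum_range_padded, sum_range_padded, IsingModel.paramDist, zero_add]
  refine h.mono ?_ fun _ h => h
  have : (0 : ℝ) ≤ n := n.cast_nonneg
  have : (0 : ℝ) ≤ m := m.cast_nonneg
  linarith

end

/-! ### The algorithm -/

section
variable {α n m : ℕ} {G : SimpleGraph (Fin n)} {E : EdgeList G m} {ν μ : IsingModel G}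
  {Ω : Type*} {O : Oracles α n Ω} {ω : ℕ → Ω}

/-- One round of sampling: draw a configuration from model `k`, compute
`r = exp (logRatio ν μ) * θ`, where `θ` is the entry 7 of the real array 6, and `|r - 1|`, and add
the value of `e`, which may refer to these numbers, to the entry 2 of the real array 7. -/
def sampleRound (k : Fin (α + 1)) (e : RealExpr) : Program α :=
  .seq (.sample k (realCell 6 1) 5) <|
  .seq logRatioProgram <|
  .seq (.setReal 7 (.const 3) (.mul (.exp (realCell 7 0)) (realCell 6 7))) <|
  .seq (.setReal 7 (.const 1) (.sub (realCell 7 3) (.ofNat (.const 1)))) <|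
  .seq (.branch (.realLt (realCell 7 1) (.ofNat (.const 0)))
    (.setReal 7 (.const 1) (.sub (.ofNat (.const 0)) (realCell 7 1)))
    (.setReal 7 (.const 1) (realCell 7 1))) <|
  .seq (.setReal 7 (.const 2) (.add (realCell 7 2) e))
    (.setNat 3 (.const 1) (.add (natCell 3 1) (.const 1)))

/-- Repeat `sampleRound` until the number of rounds, which is the entry 1 of the natural array 3,
reaches the entry 2 of the real array 6. -/
def samplePass (k : Fin (α + 1)) (e : RealExpr) : Program α :=
  .seq (.setReal 7 (.const 2) (.ofNat (.const 0))) <|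
  .seq (.setNat 3 (.const 1) (.const 0))
    (.loop (.realLt (.ofNat (natCell 3 1)) (realCell 6 2)) (sampleRound k e))

lemma halts_sampleRound {k : Fin (α + 1)} {e : RealExpr} {φ : ℝ → ℝ} {δ θ : ℝ} {s : State}
    (hs : HasInput E ν μ s) (hδ : s.real 6 1 = δ) (hδ0 : 0 < δ) (hθ : s.real 6 7 = θ)
    (he : ∀ (s' : State) (x : ℝ), s'.real 7 0 = x → s'.real 7 3 = Real.exp x * θ →
      s'.real 7 1 = |Real.exp x * θ - 1| → e.eval s' = φ x) :
    Halts O ω (sampleRound k e) s (O.sampleCost δ + 40 * (n + m) + 61 + e.cost) fun s' =>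
      OuterFrame s s' ∧ s'.calls = s.calls + 1 ∧ s'.nat 3 1 = s.nat 3 1 + 1 ∧
        s'.real 7 2 = s.real 7 2 + φ (IsingModel.logRatio ν μ (O.sample k δ (ω s.calls))) := by
  set x := IsingModel.logRatio ν μ (O.sample k δ (ω s.calls)) with hx
  have hacc : (realCell 6 1).eval s = δ := by simp [RealExpr.eval, NatExpr.eval, hδ]
  have h : Halts O ω (sampleRound k e) s ((O.sampleCost δ + 3) + ((40 * (n + m) + 20) +
      (8 + (7 + ((5 + 7) + ((e.cost + 5) + 6)))))) fun s' =>
      OuterFrame s s' ∧ s'.calls = s.calls + 1 ∧ s'.nat 3 1 = s.nat 3 1 + 1 ∧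
        s'.real 7 2 = s.real 7 2 + φ x := by
    refine Halts.seq (Halts.sample (by rwa [hacc]) ?_ ?_)
    · rw [hacc]; push_cast [RealExpr.cost, NatExpr.cost]; linarith
    rw [hacc]
    set s₁ := (s.setVec 5 (spinVec (O.sample k δ (ω s.calls)))).tick with hs₁
    have f₁ : OuterFrame s s₁ := OuterFrame.setVec_tick _ _
    have c₁ : s₁.calls = s.calls + 1 := rfl
    have n₁ : s₁.nat 3 1 = s.nat 3 1 := rfl
    have a₁ : s₁.real 7 2 = s.real 7 2 := by simp [hs₁, State.tick, State.setVec]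
    refine Halts.seq ((halts_logRatioProgram (hs.outer f₁) (σ := O.sample k δ (ω s.calls))
      ?_).mono le_rfl ?_)
    · intro v
      simp [hs₁, State.tick, State.setVec]
    rintro s₂ ⟨f₂, z₂⟩
    have c₂ : s₂.calls = s.calls + 1 := f₂.calls.trans c₁
    have n₂ : s₂.nat 3 1 = s.nat 3 1 := (f₂.nat _ _ (by norm_num)).trans n₁
    have a₂ : s₂.real 7 2 = s.real 7 2 := (f₂.real _ _ (by norm_num)).trans a₁
    have f₂' := f₁.trans f₂.outer
    have t₂ : s₂.real 6 7 = θ := (f₂'.real _ _ (by norm_num) (by norm_num)).trans hθ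
    refine Halts.seq (Halts.setReal (by norm_num [NatExpr.cost, RealExpr.cost]) ?_)
    have e₃ : (RealExpr.mul (.exp (realCell 7 0)) (realCell 6 7)).eval s₂ =
        Real.exp x * θ := by simp [RealExpr.eval, NatExpr.eval, z₂, t₂, hx]
    rw [e₃]
    set s₃ := s₂.setReal 7 ((NatExpr.const 3).eval s₂) (Real.exp x * θ) with hs₃
    have r₃ : s₃.real 7 3 = Real.exp x * θ := by simp [hs₃, State.setReal, NatExpr.eval]
    have z₃ : s₃.real 7 0 = x := by simp [hs₃, State.setReal, NatExpr.eval, z₂, hx]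
    have a₃ : s₃.real 7 2 = s.real 7 2 := by simp [hs₃, State.setReal, NatExpr.eval, a₂]
    have f₃ := f₂'.trans (OuterFrame.setReal s₂ ((NatExpr.const 3).eval s₂) (Real.exp x * θ))
    refine Halts.seq (Halts.setReal (by norm_num [NatExpr.cost, RealExpr.cost]) ?_)
    have e₄ : (RealExpr.sub (realCell 7 3) (.ofNat (.const 1))).eval s₃ =
        Real.exp x * θ - 1 := by simp [RealExpr.eval, NatExpr.eval, r₃]
    rw [e₄]
    set s₄ := s₃.setReal 7 ((NatExpr.const 1).eval s₃) (Real.exp x * θ - 1) with hs₄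
    have u₄ : s₄.real 7 1 = Real.exp x * θ - 1 := by simp [hs₄, State.setReal, NatExpr.eval]
    have r₄ : s₄.real 7 3 = Real.exp x * θ := by simp [hs₄, State.setReal, NatExpr.eval, r₃]
    have z₄ : s₄.real 7 0 = x := by simp [hs₄, State.setReal, NatExpr.eval, z₃]
    have a₄ : s₄.real 7 2 = s.real 7 2 := by simp [hs₄, State.setReal, NatExpr.eval, a₃]
    have f₄ := f₃.trans (OuterFrame.setReal s₃ ((NatExpr.const 1).eval s₃) (Real.exp x * θ - 1))
    -- both branches store the absolute value
    have last : ∀ y : ℝ, y = |Real.exp x * θ - 1| →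
        Halts O ω (.seq (.setReal 7 (.const 2) (.add (realCell 7 2) e))
          (.setNat 3 (.const 1) (.add (natCell 3 1) (.const 1))))
          (s₄.setReal 7 ((NatExpr.const 1).eval s₄) y) ((e.cost + 5) + 6) fun s' =>
            OuterFrame s s' ∧ s'.calls = s.calls + 1 ∧ s'.nat 3 1 = s.nat 3 1 + 1 ∧
              s'.real 7 2 = s.real 7 2 + φ x := by
      intro y hy
      have f₅ := f₄.trans (OuterFrame.setReal s₄ ((NatExpr.const 1).eval s₄) y)
      set s₅ := s₄.setReal 7 ((NatExpr.const 1).eval s₄) y with hs₅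
      have e₅ : e.eval s₅ = φ x := he s₅ x
        (by simp [hs₅, State.setReal, NatExpr.eval, z₄])
        (by simp [hs₅, State.setReal, NatExpr.eval, r₄])
        (by simp [hs₅, State.setReal, NatExpr.eval, hy])
      refine Halts.seq (Halts.setReal ?_ (Halts.setNat ?_ ⟨?_, ?_, ?_, ?_⟩))
      · push_cast [NatExpr.cost, RealExpr.cost]; linarith
      · norm_num [NatExpr.cost]
      · exact (f₅.trans (OuterFrame.setReal _ _ _)).trans (OuterFrame.setNat _ _ _)
      · exact c₂
      · simp only [State.setNat, State.setReal, NatExpr.eval, hs₅, hs₄, hs₃]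
        simp [n₂]
      · simp only [State.setNat, State.setReal, NatExpr.eval, RealExpr.eval, e₅]
        simp [hs₅, State.setReal, NatExpr.eval, a₄]
    refine Halts.seq (Halts.mono (T := ((Test.realLt (realCell 7 1)
      (.ofNat (.const 0))).cost : ℝ) + 7) (Halts.branch (fun hc => ?_) fun hc => ?_) ?_
      fun _ h => h)
    · refine Halts.setReal (by norm_num [NatExpr.cost, RealExpr.cost]) (last _ ?_)
      simp only [Test.holds, RealExpr.eval, NatExpr.eval, u₄, Nat.cast_zero] at hc ⊢
      rw [abs_of_neg hc, zero_sub]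
    · refine Halts.setReal (by norm_num [NatExpr.cost, RealExpr.cost]) (last _ ?_)
      simp only [Test.holds, RealExpr.eval, NatExpr.eval, u₄, Nat.cast_zero, not_lt] at hc ⊢
      rw [abs_of_nonneg hc]
    · norm_num [Test.cost, NatExpr.cost, RealExpr.cost]
  exact h.mono (by linarith) fun _ h => h

lemma halts_samplePass {k : Fin (α + 1)} {e : RealExpr} {φ : ℝ → ℝ} {δ θ B : ℝ} {s : State}
    {c : ℕ} (hs : HasInput E ν μ s) (hδ : s.real 6 1 = δ) (hδ0 : 0 < δ) (hB : s.real 6 2 = B)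
    (hθ : s.real 6 7 = θ) (hc : s.calls = c)
    (he : ∀ (s' : State) (x : ℝ), s'.real 7 0 = x → s'.real 7 3 = Real.exp x * θ →
      s'.real 7 1 = |Real.exp x * θ - 1| → e.eval s' = φ x) :
    Halts O ω (samplePass k e) s
      (⌈B⌉₊ * (O.sampleCost δ + 40 * (n + m) + 67 + e.cost) + 13) fun s' =>
      OuterFrame s s' ∧ s'.calls = c + ⌈B⌉₊ ∧ s'.nat 3 1 = ⌈B⌉₊ ∧
        s'.real 7 2 / ⌈B⌉₊ =
          seedMean (fun ξ => φ (IsingModel.logRatio ν μ (O.sample k δ ξ))) c ⌈B⌉₊ ω := by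
  set M := ⌈B⌉₊
  have h : Halts O ω (samplePass k e) s
      (4 + (3 + (M * (6 + (O.sampleCost δ + 40 * (n + m) + 61 + e.cost)) + 6))) fun s' =>
      OuterFrame s s' ∧ s'.calls = c + M ∧ s'.nat 3 1 = M ∧ s'.real 7 2 =
        ∑ j ∈ Finset.range M, φ (IsingModel.logRatio ν μ (O.sample k δ (ω (c + j)))) := by
    refine Halts.seq (Halts.setReal (by norm_num [NatExpr.cost, RealExpr.cost]) ?_)
    refine Halts.seq (Halts.setNat (by norm_num [NatExpr.cost]) ?_)
    refine (Halts.loop (T := O.sampleCost δ + 40 * (n + m) + 61 + e.cost) (M := M)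
      (fun i s' => OuterFrame s s' ∧ s'.calls = c + i ∧ s'.nat 3 1 = i ∧ s'.real 7 2 =
        ∑ j ∈ Finset.range i, φ (IsingModel.logRatio ν μ (O.sample k δ (ω (c + j)))))
      ?_ ?_ ?_).mono ?_ fun _ h => h
    · rintro i s' ⟨f, -, hi, -⟩
      have : s'.real 6 2 = B := (f.real _ _ (by norm_num) (by norm_num)).trans hB
      simp [Test.holds, RealExpr.eval, NatExpr.eval, hi, this, M, Nat.lt_ceil]
    · rintro i hi s' ⟨f, h1, h2, h3⟩
      refine (halts_sampleRound (φ := φ) (hs.outer f)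
        ((f.real _ _ (by norm_num) (by norm_num)).trans hδ) hδ0
        ((f.real _ _ (by norm_num) (by norm_num)).trans hθ) he).mono le_rfl ?_
      rintro s'' ⟨f', h1', h2', h3'⟩
      refine ⟨f.trans f', by omega, by omega, ?_⟩
      rw [h3', h3, h1, Finset.sum_range_succ]
    · refine ⟨(OuterFrame.setReal _ _ _).trans (OuterFrame.setNat _ _ _), hc, ?_, ?_⟩
      · simp [State.setNat, State.setReal, NatExpr.eval]
      · simp [State.setNat, State.setReal, NatExpr.eval, RealExpr.eval]
    · norm_num [Test.cost, NatExpr.cost, RealExpr.cost]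
  refine h.mono (by linarith) ?_
  rintro s' ⟨h1, h2, h3, h4⟩
  exact ⟨h1, h2, h3, by rw [h4, seedMean]⟩

/-- The number `(n + m) ^ k`. -/
def sizePow (k : ℕ) : RealExpr := RealExpr.pow (.ofNat (.add (natCell 0 0) (natCell 0 1))) k

/-- The accuracy `ε / (K (n + m) ^ α)` of the calls of the counting oracles. -/
def countAcc (α K : ℕ) : RealExpr :=
  .div (realCell 0 0) (.mul (.ofNat (.const K)) (sizePow α))

/-- The accuracy `ε ^ 2 / (K (n + m) ^ (2 α))` of the calls of the sampling oracles. -/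
def sampleAcc (α K : ℕ) : RealExpr :=
  .div (.mul (realCell 0 0) (realCell 0 0)) (.mul (.ofNat (.const K)) (sizePow (2 * α)))

/-- The number `K (n + m) ^ (2 α) / ε ^ 2`, which bounds the number of rounds of sampling. -/
def rounds (α K : ℕ) : RealExpr :=
  .div (.mul (.ofNat (.const K)) (sizePow (2 * α))) (.mul (realCell 0 0) (realCell 0 0))

/-- The integrand `psi α r`, where `r` and `|r - 1|` are in the entries 3 and 1 of the real
array 7. -/
def psiExpr (α : ℕ) : RealExpr :=
  .div (RealExpr.pow (realCell 7 1) α) (.add (.ofNat (.const 1)) (RealExpr.pow (realCell 7 3) α))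

/-- The mean of the values added up in the last pass. -/
def meanExpr : RealExpr := .div (realCell 7 2) (.ofNat (natCell 3 1))

lemma eval_meanExpr (s : State) : meanExpr.eval s = s.real 7 2 / (s.nat 3 1 : ℝ) := rfl

/-- The estimate of the divergence. -/
def outputExpr (α : ℕ) : RealExpr :=
  .div (.add (realCell 6 8) (.mul (.mul (.div (realCell 6 5) (realCell 6 3))
    (RealExpr.pow (.div (realCell 6 3) (realCell 6 4)) α)) meanExpr)) (.ofNat (.const 2))

/-- The deterministic preparations and the calls of the counting oracles. -/
def setupProgram (hα : 1 ≤ α) (K K' : ℕ) : Program α :=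
  .seq (.setReal 6 (.const 0) (countAcc α K)) <|
  .seq (.setReal 6 (.const 1) (sampleAcc α K)) <|
  .seq (.setReal 6 (.const 2) (rounds α K')) <|
  .seq (.count 0 (realCell 6 0) 6 (.const 3)) <|
  .seq (.count ⟨1, by omega⟩ (realCell 6 0) 6 (.const 4)) <|
  .seq (.count (Fin.last α) (realCell 6 0) 6 (.const 5)) <|
  .seq paramDistProgram (.setReal 6 (.const 6) (realCell 7 0))

/-- The passes of sampling. -/
def passesProgram : Program α :=
  .seq (samplePass 0 (.exp (realCell 7 0))) <|
  .seq (.branch (.realLt (realCell 6 6) (.ofNat (.const 1)))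
    (.setReal 6 (.const 7) (.div (.ofNat (.const 1)) meanExpr))
    (.setReal 6 (.const 7) (.div (realCell 6 3) (realCell 6 4)))) <|
  .seq (samplePass 0 (psiExpr α)) <|
  .seq (.setReal 6 (.const 8) meanExpr) <|
  .seq (samplePass (Fin.last α) (psiExpr α)) (.setReal 0 (.const 0) (outputExpr α))

/-- The estimation algorithm. The real array 6 holds the quantities that persist over the passes of
sampling: the accuracies of the oracle calls (entries 0 and 1), the bound on the number of rounds
(2), the answers of the counting oracles for the models `0`, `1` and `α` (3, 4, 5), the distance of
the parameters (6), the approximate ratio of the partition functions (7) and the mean of the second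
pass (8). The factors `K` of the accuracies and `K'` of the number of rounds depend on `α` and the
marginal bound only. -/
def algorithm (hα : 1 ≤ α) (K K' : ℕ) : Program α :=
  .seq (setupProgram hα K K') passesProgram

lemma eval_sizePow {s : State} (hs : HasInput E ν μ s) (k : ℕ) :
    (sizePow k).eval s = ((n : ℝ) + m) ^ k := by
  simp [sizePow, RealExpr.eval_pow, RealExpr.eval, NatExpr.eval, hs.card, hs.edges]

/-- The state after `setupProgram`. -/
structure IsSetUp (O : Oracles α n Ω) (ω : ℕ → Ω) (hα : 1 ≤ α) (E : EdgeList G m)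
    (ν μ : IsingModel G) (δ δ' B : ℝ) (s : State) : Prop where
  input : HasInput E ν μ s
  calls : s.calls = 3
  sampleAcc : s.real 6 1 = δ'
  rounds : s.real 6 2 = B
  count_zero : s.real 6 3 = O.count 0 δ (ω 0)
  count_one : s.real 6 4 = O.count ⟨1, by omega⟩ δ (ω 1)
  count_last : s.real 6 5 = O.count (Fin.last α) δ (ω 2)
  dist : s.real 6 6 = IsingModel.paramDist ν μ E

lemma halts_setupProgram (hα : 1 ≤ α) {K K' : ℕ} {ε δ δ' B : ℝ} (hδ0 : 0 < δ)
    (hδ : δ = ε / (K * ((n : ℝ) + m) ^ α)) (hδ' : δ' = ε ^ 2 / (K * ((n : ℝ) + m) ^ (2 * α)))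
    (hB : B = K' * ((n : ℝ) + m) ^ (2 * α) / ε ^ 2) :
    Halts O ω (setupProgram hα K K') (inputState E ν μ ε)
      (((countAcc α K).cost + (sampleAcc α K).cost + (rounds α K').cost + 42) +
        3 * O.countCost δ + 40 * (n + m)) (IsSetUp O ω hα E ν μ δ δ' B) := by
  have h : Halts O ω (setupProgram hα K K') (inputState E ν μ ε)
      (((countAcc α K).cost + 2) + (((sampleAcc α K).cost + 2) + (((rounds α K').cost + 2) +
        ((O.countCost δ + 4) + ((O.countCost δ + 4) + ((O.countCost δ + 4) +
          ((40 * (n + m) + 20) + 4))))))) (IsSetUp O ω hα E ν μ δ δ' B) := by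
    have h₀ : HasInput E ν μ (inputState E ν μ ε) := hasInput_inputState ε
    have ε₀ : (inputState E ν μ ε).real 0 0 = ε := by simp [inputState, padded]
    have c₀ : (inputState E ν μ ε).calls = 0 := rfl
    revert h₀ ε₀ c₀
    generalize inputState E ν μ ε = s₀
    intro h₀ ε₀ c₀
    refine Halts.seq (Halts.setReal (by push_cast [NatExpr.cost]; linarith) ?_)
    have e₁ : (countAcc α K).eval s₀ = δ := by
      simp [countAcc, RealExpr.eval, NatExpr.eval, eval_sizePow h₀, ε₀, hδ]
    have h₁ := h₀.setReal (a := 6) (by norm_num) ((NatExpr.const 0).eval s₀)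
      ((countAcc α K).eval s₀)
    set s₁ := s₀.setReal 6 ((NatExpr.const 0).eval s₀) ((countAcc α K).eval s₀) with hs₁
    have ε₁ : s₁.real 0 0 = ε := by simp [hs₁, State.setReal, ε₀]
    have d₁ : s₁.real 6 0 = δ := by simp [hs₁, State.setReal, NatExpr.eval, e₁]
    have c₁ : s₁.calls = 0 := c₀
    clear_value s₁
    refine Halts.seq (Halts.setReal (by push_cast [NatExpr.cost]; linarith) ?_)
    have e₂ : (sampleAcc α K).eval s₁ = δ' := by
      simp [sampleAcc, RealExpr.eval, NatExpr.eval, eval_sizePow h₁, ε₁, hδ', sq]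
    have h₂ := h₁.setReal (a := 6) (by norm_num) ((NatExpr.const 1).eval s₁)
      ((sampleAcc α K).eval s₁)
    set s₂ := s₁.setReal 6 ((NatExpr.const 1).eval s₁) ((sampleAcc α K).eval s₁) with hs₂
    have ε₂ : s₂.real 0 0 = ε := by simp [hs₂, State.setReal, ε₁]
    have d₂ : s₂.real 6 0 = δ := by simp [hs₂, State.setReal, NatExpr.eval, d₁]
    have d'₂ : s₂.real 6 1 = δ' := by simp [hs₂, State.setReal, NatExpr.eval, e₂]
    have c₂ : s₂.calls = 0 := c₁
    clear_value s₂
    refine Halts.seq (Halts.setReal (by push_cast [NatExpr.cost]; linarith) ?_)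
    have e₃ : (rounds α K').eval s₂ = B := by
      simp [rounds, RealExpr.eval, NatExpr.eval, eval_sizePow h₂, ε₂, hB, sq]
    have h₃ := h₂.setReal (a := 6) (by norm_num) ((NatExpr.const 2).eval s₂)
      ((rounds α K').eval s₂)
    set s₃ := s₂.setReal 6 ((NatExpr.const 2).eval s₂) ((rounds α K').eval s₂) with hs₃
    have d₃ : s₃.real 6 0 = δ := by simp [hs₃, State.setReal, NatExpr.eval, d₂]
    have d'₃ : s₃.real 6 1 = δ' := by simp [hs₃, State.setReal, NatExpr.eval, d'₂]
    have b₃ : s₃.real 6 2 = B := by simp [hs₃, State.setReal, NatExpr.eval, e₃]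
    have c₃ : s₃.calls = 0 := c₂
    clear_value s₃
    have acc : ∀ s : State, s.real 6 0 = δ → (realCell 6 0).eval s = δ := fun s hs => by
      simp [RealExpr.eval, NatExpr.eval, hs]
    have e₄ := acc s₃ d₃
    refine Halts.seq (Halts.count (by rwa [e₄])
      (by rw [e₄]; push_cast [RealExpr.cost, NatExpr.cost]; linarith) ?_)
    rw [e₄, c₃]
    have h₄ := (h₃.setReal (a := 6) (by norm_num) ((NatExpr.const 3).eval s₃)
      (O.count 0 δ (ω 0))).tick
    set s₄ := (s₃.setReal 6 ((NatExpr.const 3).eval s₃) (O.count 0 δ (ω 0))).tick with hs₄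
    have d₄ : s₄.real 6 0 = δ := by simp [hs₄, State.tick, State.setReal, NatExpr.eval, d₃]
    have d'₄ : s₄.real 6 1 = δ' := by simp [hs₄, State.tick, State.setReal, NatExpr.eval, d'₃]
    have b₄ : s₄.real 6 2 = B := by simp [hs₄, State.tick, State.setReal, NatExpr.eval, b₃]
    have x₄ : s₄.real 6 3 = O.count 0 δ (ω 0) := by
      simp [hs₄, State.tick, State.setReal, NatExpr.eval]
    have c₄ : s₄.calls = 1 := by simp [hs₄, State.tick, State.setReal, c₃]
    clear_value s₄
    have e₅ := acc s₄ d₄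
    refine Halts.seq (Halts.count (by rwa [e₅])
      (by rw [e₅]; push_cast [RealExpr.cost, NatExpr.cost]; linarith) ?_)
    rw [e₅, c₄]
    set z₁ := O.count ⟨1, by omega⟩ δ (ω 1) with hz₁
    have h₅ := (h₄.setReal (a := 6) (by norm_num) ((NatExpr.const 4).eval s₄) z₁).tick
    set s₅ := (s₄.setReal 6 ((NatExpr.const 4).eval s₄) z₁).tick with hs₅
    have d₅ : s₅.real 6 0 = δ := by simp [hs₅, State.tick, State.setReal, NatExpr.eval, d₄]
    have d'₅ : s₅.real 6 1 = δ' := by simp [hs₅, State.tick, State.setReal, NatExpr.eval, d'₄]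
    have b₅ : s₅.real 6 2 = B := by simp [hs₅, State.tick, State.setReal, NatExpr.eval, b₄]
    have x₅ : s₅.real 6 3 = O.count 0 δ (ω 0) := by
      simp [hs₅, State.tick, State.setReal, NatExpr.eval, x₄]
    have y₅ : s₅.real 6 4 = z₁ := by simp [hs₅, State.tick, State.setReal, NatExpr.eval]
    have c₅ : s₅.calls = 2 := by simp [hs₅, State.tick, State.setReal, c₄]
    clear_value s₅
    have e₆ := acc s₅ d₅
    refine Halts.seq (Halts.count (by rwa [e₆])
      (by rw [e₆]; push_cast [RealExpr.cost, NatExpr.cost]; linarith) ?_)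
    rw [e₆, c₅]
    set z := O.count (Fin.last α) δ (ω 2) with hz
    have h₆ := (h₅.setReal (a := 6) (by norm_num) ((NatExpr.const 5).eval s₅) z).tick
    set s₆ := (s₅.setReal 6 ((NatExpr.const 5).eval s₅) z).tick with hs₆
    have d'₆ : s₆.real 6 1 = δ' := by simp [hs₆, State.tick, State.setReal, NatExpr.eval, d'₅]
    have b₆ : s₆.real 6 2 = B := by simp [hs₆, State.tick, State.setReal, NatExpr.eval, b₅]
    have x₆ : s₆.real 6 3 = O.count 0 δ (ω 0) := by
      simp [hs₆, State.tick, State.setReal, NatExpr.eval, x₅]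
    have y₆ : s₆.real 6 4 = z₁ := by simp [hs₆, State.tick, State.setReal, NatExpr.eval, y₅]
    have w₆ : s₆.real 6 5 = z := by simp [hs₆, State.tick, State.setReal, NatExpr.eval]
    have c₆ : s₆.calls = 3 := by simp [hs₆, State.tick, State.setReal, c₅]
    clear_value s₆
    refine Halts.seq ((halts_paramDistProgram h₆).mono le_rfl ?_)
    rintro s₇ ⟨f, l₇⟩
    have reg : ∀ i, s₇.real 6 i = s₆.real 6 i := fun i => f.real _ _ (by norm_num)
    refine Halts.setReal (by norm_num [RealExpr.cost, NatExpr.cost]) ⟨?_, ?_, ?_, ?_, ?_, ?_, ?_, ?_⟩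
    · exact (h₆.outer f.outer).setReal (by norm_num) _ _
    · exact f.calls.trans c₆
    all_goals simp [State.setReal, NatExpr.eval, RealExpr.eval, reg, d'₆, b₆, x₆, y₆, w₆, l₇, z, z₁]
  exact h.mono (by linarith) fun _ h => h

lemma eval_psiExpr (θ : ℝ) (s : State) (x : ℝ) (_ : s.real 7 0 = x)
    (h3 : s.real 7 3 = Real.exp x * θ) (h1 : s.real 7 1 = |Real.exp x * θ - 1|) :
    (psiExpr α).eval s = psi α (Real.exp x * θ) := by
  simp [psiExpr, psi, RealExpr.eval, RealExpr.eval_pow, NatExpr.eval, h3, h1]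

/-- The output of the algorithm on answers `z₀`, `z₁`, `z` of the counting oracles, the mean `a` of
the first pass and the means `a₀ θ` and `a₁ θ` of the following passes, which depend on the
approximate ratio `θ` of the partition functions. -/
noncomputable def estimate (α : ℕ) (L z₀ z₁ z a : ℝ) (a₀ a₁ : ℝ → ℝ) : ℝ :=
  (a₀ (thetaHat L a z₀ z₁) + z / z₀ * (z₀ / z₁) ^ α * a₁ (thetaHat L a z₀ z₁)) / 2

lemma halts_passesProgram (hα : 1 ≤ α) {δ δ' B : ℝ} {s : State} (hδ' : 0 < δ')
    (hs : IsSetUp O ω hα E ν μ δ δ' B s) :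
    Halts O ω (passesProgram (α := α)) s
      (3 * ⌈B⌉₊ * (O.sampleCost δ' + 40 * (n + m) + 67 + (3 + (psiExpr α).cost)) +
        (70 + (outputExpr α).cost)) fun s' =>
      s'.output = estimate α (IsingModel.paramDist ν μ E) (O.count 0 δ (ω 0))
        (O.count ⟨1, by omega⟩ δ (ω 1)) (O.count (Fin.last α) δ (ω 2))
        (seedMean (fun ξ => Real.exp (IsingModel.logRatio ν μ (O.sample 0 δ' ξ))) 3 ⌈B⌉₊ ω)
        (fun θ => seedMean (fun ξ => psi α
          (Real.exp (IsingModel.logRatio ν μ (O.sample 0 δ' ξ)) * θ)) (3 + ⌈B⌉₊) ⌈B⌉₊ ω)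
        (fun θ => seedMean (fun ξ => psi α
          (Real.exp (IsingModel.logRatio ν μ (O.sample (Fin.last α) δ' ξ)) * θ))
            (3 + ⌈B⌉₊ + ⌈B⌉₊) ⌈B⌉₊ ω) := by
  set M := ⌈B⌉₊
  have hcost : ((RealExpr.exp (realCell 7 0)).cost : ℝ) = 3 := by
    norm_num [RealExpr.cost, NatExpr.cost]
  have hM : (0 : ℝ) ≤ M := M.cast_nonneg
  have hψ : (0 : ℝ) ≤ (psiExpr α).cost := Nat.cast_nonneg _
  set z₀ := O.count 0 δ (ω 0)
  set z₁ := O.count ⟨1, by omega⟩ δ (ω 1)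
  set z := O.count (Fin.last α) δ (ω 2)
  set L := IsingModel.paramDist ν μ E
  set T := O.sampleCost δ' + 40 * (n + m) + 67 with hT
  set a := seedMean (fun ξ => Real.exp (IsingModel.logRatio ν μ (O.sample 0 δ' ξ))) 3 M ω
    with ha
  have h : Halts O ω (passesProgram (α := α)) s
      ((M * (T + 3) + 13) + ((6 + 12) + ((M * (T + (psiExpr α).cost) + 13) + (8 +
        ((M * (T + (psiExpr α).cost) + 13) + ((outputExpr α).cost + 2)))))) fun s' =>
      s'.output = estimate α L z₀ z₁ z a
        (fun θ => seedMean (fun ξ => psi α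
          (Real.exp (IsingModel.logRatio ν μ (O.sample 0 δ' ξ)) * θ)) (3 + M) M ω)
        (fun θ => seedMean (fun ξ => psi α
          (Real.exp (IsingModel.logRatio ν μ (O.sample (Fin.last α) δ' ξ)) * θ))
            (3 + M + M) M ω) := by
    refine Halts.seq ((halts_samplePass (φ := Real.exp) hs.input hs.sampleAcc hδ' hs.rounds rfl
      hs.calls ?_).mono (by rw [hcost]) ?_)
    · rintro s' x h0 - -
      simp [RealExpr.eval, NatExpr.eval, h0]
    rintro s₁ ⟨f₁, c₁, n₁, a₁⟩
    have reg₁ : ∀ i, s₁.real 6 i = s.real 6 i := fun i => f₁.real _ _ (by norm_num) (by norm_num)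
    have i₁ := hs.input.outer f₁
    have m₁ : meanExpr.eval s₁ = a := by rw [eval_meanExpr, n₁, a₁]
    set θ := thetaHat L a z₀ z₁ with hθ
    -- both branches store the approximate ratio
    have rest : Halts O ω (.seq (samplePass 0 (psiExpr α)) <|
        .seq (.setReal 6 (.const 8) meanExpr) <|
        .seq (samplePass (Fin.last α) (psiExpr α)) (.setReal 0 (.const 0) (outputExpr α)))
        (s₁.setReal 6 ((NatExpr.const 7).eval s₁) θ)
        ((M * (T + (psiExpr α).cost) + 13) + (8 +
        ((M * (T + (psiExpr α).cost) + 13) + ((outputExpr α).cost + 2)))) fun s' =>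
        s'.output = estimate α L z₀ z₁ z a
          (fun θ => seedMean (fun ξ => psi α
            (Real.exp (IsingModel.logRatio ν μ (O.sample 0 δ' ξ)) * θ)) (3 + M) M ω)
          (fun θ => seedMean (fun ξ => psi α
            (Real.exp (IsingModel.logRatio ν μ (O.sample (Fin.last α) δ' ξ)) * θ))
              (3 + M + M) M ω) := by
      have i₂ := i₁.setReal (a := 6) (by norm_num) ((NatExpr.const 7).eval s₁) θ
      set s₂ := s₁.setReal 6 ((NatExpr.const 7).eval s₁) θ with hs₂
      have c₂ : s₂.calls = 3 + M := c₁
      have t₂ : s₂.real 6 7 = θ := by simp [hs₂, State.setReal, NatExpr.eval]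
      have reg₂ : ∀ i, i ≠ 7 → s₂.real 6 i = s.real 6 i := fun i hi => by
        simp [hs₂, State.setReal, NatExpr.eval, hi, reg₁]
      clear_value s₂
      refine Halts.seq ((halts_samplePass (φ := fun x => psi α (Real.exp x * θ)) i₂
        ((reg₂ 1 (by norm_num)).trans hs.sampleAcc) hδ' ((reg₂ 2 (by norm_num)).trans hs.rounds)
        t₂ c₂ (eval_psiExpr θ)).mono le_rfl ?_)
      rintro s₃ ⟨f₃, c₃, n₃, a₃⟩
      have m₃ := eval_meanExpr s₃
      rw [n₃, a₃] at m₃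
      refine Halts.seq (Halts.setReal (by norm_num [meanExpr, RealExpr.cost, NatExpr.cost]) ?_)
      rw [m₃]
      have i₄ := (i₂.outer f₃).setReal (a := 6) (by norm_num) ((NatExpr.const 8).eval s₃)
        (seedMean (fun ξ => psi α
          (Real.exp (IsingModel.logRatio ν μ (O.sample 0 δ' ξ)) * θ)) (3 + M) M ω)
      set s₄ := s₃.setReal 6 ((NatExpr.const 8).eval s₃) (seedMean (fun ξ => psi α
        (Real.exp (IsingModel.logRatio ν μ (O.sample 0 δ' ξ)) * θ)) (3 + M) M ω) with hs₄
      have c₄ : s₄.calls = 3 + M + M := c₃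
      have reg₄ : ∀ i, i ≠ 8 → s₄.real 6 i = s₂.real 6 i := fun i hi => by
        simp only [hs₄, State.setReal, NatExpr.eval, hi, and_false, if_false]
        exact f₃.real _ _ (by norm_num) (by norm_num)
      have v₄ : s₄.real 6 8 = seedMean (fun ξ => psi α
          (Real.exp (IsingModel.logRatio ν μ (O.sample 0 δ' ξ)) * θ)) (3 + M) M ω := by
        simp [hs₄, State.setReal, NatExpr.eval]
      clear_value s₄
      refine Halts.seq ((halts_samplePass (φ := fun x => psi α (Real.exp x * θ)) i₄
        ((reg₄ 1 (by norm_num)).trans ((reg₂ 1 (by norm_num)).trans hs.sampleAcc)) hδ'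
        ((reg₄ 2 (by norm_num)).trans ((reg₂ 2 (by norm_num)).trans hs.rounds))
        ((reg₄ 7 (by norm_num)).trans t₂) c₄ (eval_psiExpr θ)).mono le_rfl ?_)
      rintro s₅ ⟨f₅, c₅, n₅, a₅⟩
      have m₅ := eval_meanExpr s₅
      rw [n₅, a₅] at m₅
      have reg₅ : ∀ i, s₅.real 6 i = s₄.real 6 i := fun i =>
        f₅.real _ _ (by norm_num) (by norm_num)
      have x₅ : s₅.real 6 3 = z₀ := by
        rw [reg₅, reg₄ _ (by norm_num), reg₂ _ (by norm_num), hs.count_zero]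
      have y₅ : s₅.real 6 4 = z₁ := by
        rw [reg₅, reg₄ _ (by norm_num), reg₂ _ (by norm_num), hs.count_one]
      have w₅ : s₅.real 6 5 = z := by
        rw [reg₅, reg₄ _ (by norm_num), reg₂ _ (by norm_num), hs.count_last]
      refine Halts.setReal (by push_cast [NatExpr.cost]; linarith) ?_
      simp only [State.output, State.setReal, NatExpr.eval, and_self, if_true]
      simp only [outputExpr, RealExpr.eval, RealExpr.eval_pow, NatExpr.eval, m₅, x₅, y₅, w₅,
        reg₅ 8, v₄, estimate, ← hθ, Nat.cast_ofNat]
      rfl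
    have hL₁ : s₁.real 6 6 = L := (reg₁ 6).trans hs.dist
    refine Halts.seq (Halts.mono (T := ((Test.realLt (realCell 6 6)
      (.ofNat (.const 1))).cost : ℝ) + 12) (Halts.branch (fun hc => ?_) fun hc => ?_) ?_
      fun _ h => h)
    · refine Halts.setReal (by norm_num [meanExpr, RealExpr.cost, NatExpr.cost]) ?_
      convert rest using 2
      simp only [Test.holds, RealExpr.eval, NatExpr.eval, hL₁, Nat.cast_one] at hc ⊢
      rw [m₁, hθ, thetaHat, if_pos hc]
    · refine Halts.setReal (by norm_num [RealExpr.cost, NatExpr.cost]) ?_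
      convert rest using 2
      simp only [Test.holds, RealExpr.eval, NatExpr.eval, hL₁, Nat.cast_one] at hc ⊢
      rw [reg₁ 3, reg₁ 4, hs.count_zero, hs.count_one, hθ, thetaHat, if_neg hc]
    · norm_num [Test.cost, NatExpr.cost, RealExpr.cost]
  refine h.mono ?_ fun _ h => h
  nlinarith [mul_nonneg hM hψ]

end

/-! ### Success probability and running time -/

section
open MeasureTheory

lemma measureReal_add_sub_one_le_inter {Ω : Type*} [MeasurableSpace Ω] (Q : Measure Ω)
    [IsProbabilityMeasure Q] {s t : Set Ω} (ht : MeasurableSet t) {p q : ℝ} (hp : p ≤ Q.real s)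
    (hq : q ≤ Q.real t) : p + q - 1 ≤ Q.real (s ∩ t) := by
  have h1 := measureReal_union_add_inter (μ := Q) (s := s) ht
  have h2 : Q.real (s ∪ t) ≤ 1 := measureReal_le_one
  linarith

/-- With high probability the empirical mean of a bounded function of samples is accurate. -/
lemma exists_event_seedMean {X : Type*} [Fintype X] {Ω : Type*} [MeasurableSpace Ω]
    {P : Measure Ω} [IsProbabilityMeasure P] {S : Ω → X}
    (hS : ∀ x, MeasurableSet {ξ | S ξ = x}) {q : X → ℝ} {δ : ℝ}
    (hδ : tvDist (fun x => P.real {ξ | S ξ = x}) q ≤ δ) {F : X → ℝ} {B : ℝ}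
    (hB : ∀ x, |F x| ≤ B) (c : ℕ) {M : ℕ} (hM : 0 < M) {t s : ℝ} (ht : 0 < t)
    (hMt : 20 ≤ M * t ^ 2) (hs : t + 2 * δ ≤ s) :
    ∃ A : Set (ℕ → Ω), MeasurableSet A ∧
      95 / 100 ≤ (Measure.infinitePi fun _ : ℕ => P).real A ∧
      ∀ ω ∈ A, |seedMean (fun ξ => F (S ξ)) c M ω - ∑ x, q x * F x| ≤ s * B := by
  obtain ⟨ω₀⟩ : Nonempty Ω := nonempty_of_isProbabilityMeasure P
  have hB0 : 0 ≤ B := (abs_nonneg _).trans (hB (S ω₀))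
  have hmeas := measurable_seedMean (measurable_comp_of_fibers hS F) c M
  set A := {ω : ℕ → Ω | (t + 2 * δ) * B <
    |seedMean (fun ξ => F (S ξ)) c M ω - ∑ x, q x * F x|} with hA
  have hAmeas : MeasurableSet A := measurableSet_lt measurable_const (hmeas.sub_const _).abs
  refine ⟨Aᶜ, hAmeas.compl, ?_, fun ω hω => ?_⟩
  · rw [probReal_compl_eq_one_sub hAmeas]
    have h1 := measureReal_seedMean_comp_le hS hδ hB c hM ht
    have h2 : 1 / (M * t ^ 2) ≤ 1 / 20 := one_div_le_one_div_of_le (by norm_num) hMt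
    linarith
  · have : |seedMean (fun ξ => F (S ξ)) c M ω - ∑ x, q x * F x| ≤ (t + 2 * δ) * B :=
      not_lt.1 hω
    exact this.trans (mul_le_mul_of_nonneg_right hs hB0)

lemma exists_event_count {Ω V : Type*} [MeasurableSpace Ω] [Fintype V] [DecidableEq V]
    {G : SimpleGraph V} {P : Measure Ω} [IsProbabilityMeasure P] {M : IsingModel G}
    {A : ℝ → Ω → ℝ} (h : IsCountingOracle P M A) {δ : ℝ} (hδ : 0 < δ) (j : ℕ) :
    ∃ B : Set (ℕ → Ω), MeasurableSet B ∧
      99 / 100 ≤ (Measure.infinitePi fun _ : ℕ => P).real B ∧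
      ∀ ω ∈ B, Real.exp (-δ) * M.Z ≤ A δ (ω j) ∧ A δ (ω j) ≤ Real.exp δ * M.Z := by
  obtain ⟨h1, h2⟩ := h δ hδ
  have h3 : MeasurableSet {ξ | Real.exp (-δ) * M.Z ≤ A δ ξ ∧ A δ ξ ≤ Real.exp δ * M.Z} :=
    (measurableSet_le measurable_const h1).inter (measurableSet_le h1 measurable_const)
  exact ⟨_, (measurable_pi_apply j) h3, by rw [← measureReal_seed P j h3] at h2; exact h2,
    fun ω hω => hω⟩

/-- The tolerance `t = ε / (K N ^ α)` for empirical means in relation to the accuracies of the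
oracles and to the number of samples. -/
lemma tolerance_spec {α M : ℕ} {K N ε δ δ' : ℝ} (hK : 2048 * α * 64 ^ α ≤ K) (hKpos : 0 < K)
    (hN1 : 1 ≤ N) (hε : 0 < ε) (hε1 : ε ≤ 1) (hδ : δ = ε / (2 * K * N ^ α))
    (hδ' : δ' = ε ^ 2 / (2 * K * N ^ (2 * α)))
    (hM : 20 * K ^ 2 * N ^ (2 * α) / ε ^ 2 ≤ M) :
    0 < ε / (K * N ^ α) ∧ δ = ε / (K * N ^ α) / 2 ∧
      ε / (K * N ^ α) + 2 * δ' ≤ 2 * (ε / (K * N ^ α)) ∧ 20 ≤ M * (ε / (K * N ^ α)) ^ 2 ∧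
      2048 * α * 2 ^ α * (ε / (K * N ^ α)) ≤ ε := by
  have hNα : 1 ≤ N ^ α := one_le_pow₀ hN1
  have hNα0 : 0 < N ^ α := by linarith
  have hN2α : N ^ (2 * α) = (N ^ α) ^ 2 := by rw [mul_comm, pow_mul]
  set t := ε / (K * N ^ α) with ht
  have ht0 : 0 < t := by positivity
  refine ⟨ht0, by rw [hδ, ht]; field_simp, ?_, ?_, ?_⟩
  · have h1 : 2 * δ' = t * (ε / N ^ α) := by rw [hδ', hN2α, ht]; field_simp
    have h2 : ε / N ^ α ≤ 1 := (div_le_one hNα0).2 (by linarith)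
    rw [h1]
    nlinarith
  · calc (20 : ℝ) = 20 * K ^ 2 * N ^ (2 * α) / ε ^ 2 * t ^ 2 := by
          rw [hN2α, ht]; field_simp
      _ ≤ M * t ^ 2 := by gcongr
  · calc 2048 * α * 2 ^ α * t ≤ 2048 * α * 64 ^ α * t := by gcongr; norm_num
      _ ≤ K * t := by gcongr
      _ = ε / N ^ α := by rw [ht]; field_simp
      _ ≤ ε := div_le_self hε.le hNα

open IsingModel in
/-- With probability at least `2 / 3` the answers of the oracles make the estimate accurate. -/
theorem exists_event_estimate {α : ℕ} (hα : 1 ≤ α) {b : ℝ} (hb : 0 < b) (hb1 : b < 1) {n m : ℕ}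
    (hn : 1 ≤ n) {G : SimpleGraph (Fin n)} (E : EdgeList G m) {ν μ : IsingModel G}
    (hν : ν.MarginallyBounded b) (hμ : μ.MarginallyBounded b) {Ω : Type*} [MeasurableSpace Ω]
    {P : Measure Ω} [IsProbabilityMeasure P] {O : Oracles α n Ω}
    (hS : ∀ k : Fin (α + 1), IsSamplingOracle P (ν.interp μ k) (O.sample k))
    (hC : ∀ k : Fin (α + 1), IsCountingOracle P (ν.interp μ k) (O.count k))
    {ε δ δ' : ℝ} {M : ℕ} (hε : 0 < ε) (hε1 : ε < 1)
    (hδ : δ = ε / (2 * scale α b * ((n : ℝ) + m) ^ α))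
    (hδ' : δ' = ε ^ 2 / (2 * scale α b * ((n : ℝ) + m) ^ (2 * α)))
    (hM : 20 * (scale α b : ℝ) ^ 2 * ((n : ℝ) + m) ^ (2 * α) / ε ^ 2 ≤ M) :
    ∃ A : Set (ℕ → Ω), MeasurableSet A ∧
      2 / 3 ≤ (Measure.infinitePi fun _ : ℕ => P).real A ∧
      ∀ ω ∈ A, ∀ D, D = estimate α (paramDist ν μ E) (O.count 0 δ (ω 0))
        (O.count ⟨1, by omega⟩ δ (ω 1)) (O.count (Fin.last α) δ (ω 2))
        (seedMean (fun ξ => Real.exp (logRatio ν μ (O.sample 0 δ' ξ))) 3 M ω)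
        (fun θ => seedMean (fun ξ => psi α
          (Real.exp (logRatio ν μ (O.sample 0 δ' ξ)) * θ)) (3 + M) M ω)
        (fun θ => seedMean (fun ξ => psi α
          (Real.exp (logRatio ν μ (O.sample (Fin.last α) δ' ξ)) * θ)) (3 + M + M) M ω) →
        Real.exp (-ε) * chiDivergence α ν.gibbs μ.gibbs ≤ D ∧
          D ≤ Real.exp ε * chiDivergence α ν.gibbs μ.gibbs := by
  classical
  have hK := mul_le_scale (α := α) hb
  have hKnat := scale_pos hα hb
  set K : ℝ := (scale α b : ℝ) with hKdef
  have hKpos : 0 < K := Nat.cast_pos.2 hKnat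
  set N : ℝ := (n : ℝ) + m with hN
  have hN1 : 1 ≤ N := by
    have h1 : (1 : ℝ) ≤ n := by exact_mod_cast hn
    have h2 : (0 : ℝ) ≤ m := m.cast_nonneg
    linarith
  have hα' : (1 : ℝ) ≤ α := by exact_mod_cast hα
  set L := paramDist ν μ E with hL
  have hL0 : 0 ≤ L := paramDist_nonneg ν μ E
  set lam := min L 1 with hlam
  have hlam0 : 0 ≤ lam := le_min hL0 zero_le_one
  -- the tolerance for the empirical means
  set t := ε / (K * N ^ α) with ht
  set s := 2 * t with hs
  obtain ⟨ht0, hδt, hδ't, hMt, hα2⟩ := tolerance_spec hK hKpos hN1 hε hε1.le hδ hδ' hM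
  rw [← ht] at ht0 hδt hδ't hMt hα2
  have h2α : (1 : ℝ) ≤ 2 ^ α := one_le_pow₀ (by norm_num)
  have hαt : 2048 * α * t ≤ ε := by
    refine le_trans ?_ hα2
    have : 0 ≤ 2048 * α * t := by positivity
    nlinarith only [this, h2α]
  have htε : 2048 * t ≤ ε := by nlinarith only [hαt, hα', ht0]
  have hδpos : 0 < δ := by rw [hδt]; positivity
  have hδ'pos : 0 < δ' := by rw [hδ']; positivity
  have hMpos : 0 < M := by
    rcases Nat.eq_zero_or_pos M with h | h
    · rw [h, Nat.cast_zero, zero_mul] at hMt; norm_num at hMt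
    · exact h
  have hMpos' : (0 : ℝ) < M := by exact_mod_cast hMpos
  -- the events
  have hS0 : IsSamplingOracle P (ν.interp μ 0) (O.sample 0) := by simpa using hS 0
  have hS1 : IsSamplingOracle P (ν.interp μ α) (O.sample (Fin.last α)) := by
    simpa using hS (Fin.last α)
  have hC0 : IsCountingOracle P (ν.interp μ 0) (O.count 0) := by simpa using hC 0
  have hC1 : IsCountingOracle P (ν.interp μ 1) (O.count ⟨1, by omega⟩) := hC ⟨1, by omega⟩
  have hC2 : IsCountingOracle P (ν.interp μ α) (O.count (Fin.last α)) := by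
    simpa using hC (Fin.last α)
  obtain ⟨hS0m, hS0t⟩ := hS0 δ' hδ'pos
  obtain ⟨hS1m, hS1t⟩ := hS1 δ' hδ'pos
  have hg0 : (ν.interp μ 0).gibbs = μ.gibbs := funext (gibbs_interp_zero ν μ)
  rw [hg0] at hS0t
  obtain ⟨A₀, mA₀, pA₀, hA₀⟩ := exists_event_count hC0 hδpos 0
  obtain ⟨A₁, mA₁, pA₁, hA₁⟩ := exists_event_count hC1 hδpos 1
  obtain ⟨A₂, mA₂, pA₂, hA₂⟩ := exists_event_count hC2 hδpos 2
  rw [Z_interp_zero] at hA₀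
  rw [Z_interp_one] at hA₁
  obtain ⟨A₃, mA₃, pA₃, hA₃⟩ := exists_event_seedMean hS0m hS0t
    (F := fun σ => if L < 1 then Real.exp (logRatio ν μ σ) - 1 else 0) (B := 2 * lam)
    (fun σ => by
      split_ifs with h
      · rw [hlam, min_eq_left h.le]
        exact abs_exp_sub_one_le_of_abs_le (abs_logRatio_le ν μ E σ) h.le
      · rw [abs_zero]; positivity) 3 hMpos ht0 hMt hδ't
  have hψ : ∀ σ, |psi α (ratio ν μ σ)| ≤ (16 * lam) ^ α := fun σ => by
    rw [abs_of_nonneg (psi_nonneg α (ratio_pos ν μ σ).le)]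
    exact psi_le_pow (ratio_pos ν μ σ).le (by positivity) (abs_ratio_sub_one_le ν μ E σ)
  obtain ⟨A₄, mA₄, pA₄, hA₄⟩ := exists_event_seedMean hS0m hS0t
    (F := fun σ => psi α (ratio ν μ σ)) hψ (3 + M) hMpos ht0 hMt hδ't
  obtain ⟨A₅, mA₅, pA₅, hA₅⟩ := exists_event_seedMean hS1m hS1t
    (F := fun σ => psi α (ratio ν μ σ)) hψ (3 + M + M) hMpos ht0 hMt hδ't
  refine ⟨A₀ ∩ A₁ ∩ A₂ ∩ A₃ ∩ A₄ ∩ A₅, ((((mA₀.inter mA₁).inter mA₂).inter mA₃).inter mA₄).inter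
    mA₅, ?_, ?_⟩
  · refine le_trans (by norm_num) (measureReal_add_sub_one_le_inter _ mA₅
      (measureReal_add_sub_one_le_inter _ mA₄ (measureReal_add_sub_one_le_inter _ mA₃
      (measureReal_add_sub_one_le_inter _ mA₂ (measureReal_add_sub_one_le_inter _ mA₁ pA₀ pA₁)
      pA₂) pA₃) pA₄) pA₅)
  rintro ω ⟨⟨⟨⟨⟨ω₀, ω₁⟩, ω₂⟩, ω₃⟩, ω₄⟩, ω₅⟩ D rfl
  have z₀ := hA₀ ω ω₀
  have z₁ := hA₁ ω ω₁
  have z₂ := hA₂ ω ω₂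
  have m₃ := hA₃ ω ω₃
  have m₄ := hA₄ ω ω₄
  have m₅ := hA₅ ω ω₅
  -- the first pass approximates the ratio of the partition functions
  have hratio : L < 1 → |seedMean (fun ξ => Real.exp (logRatio ν μ (O.sample 0 δ' ξ))) 3 M ω -
      ν.Z / μ.Z| ≤ s * (2 * lam) := by
    intro h
    simp only [if_pos h] at m₃
    refine le_trans (le_of_eq ?_) m₃
    congr 1
    have h1 : ∑ σ, μ.gibbs σ * (Real.exp (logRatio ν μ σ) - 1) = ν.Z / μ.Z - 1 := by
      rw [Z_div_Z_eq_sum]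
      simp only [mul_sub, mul_one, Finset.sum_sub_distrib, sum_gibbs]
    rw [h1, seedMean, seedMean, Finset.sum_sub_distrib]
    simp only [Finset.sum_const, Finset.card_range, nsmul_eq_mul, mul_one]
    field_simp
    ring
  have hθ := abs_thetaHat_div_sub_one_le ν μ E (s := s) (by linarith only [htε, hε1, hs])
    (by linarith only [hδt, hs, ht0]) hratio z₀ z₁
  set θ := thetaHat L (seedMean (fun ξ => Real.exp (logRatio ν μ (O.sample 0 δ' ξ))) 3 M ω)
    (O.count 0 δ (ω 0)) (O.count ⟨1, by omega⟩ δ (ω 1)) with hθdef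
  have hpt := abs_psi_exp_mul_sub_le ν μ E hα (s := s) (by positivity) (by
    have h : 0 ≤ α * 2 ^ α * t := by positivity
    linarith only [h, hα2, hε1, hs]) hθ
  have hmom := abs_momentHat_sub_le ν μ hα (δ := δ)
    (by rw [hδt]; linarith only [hαt, hε1, hε]) z₀ z₁ z₂
  -- the total error of a mean of the integrand
  set e := 128 * α * 32 ^ α * (ε / K) * (lam / N) ^ α with he
  have htot : 48 * α * 32 ^ α * s * lam ^ α + s * (16 * lam) ^ α ≤ e := by
    have h1 : e = 128 * α * 32 ^ α * t * lam ^ α := by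
      rw [he, ht, div_pow]; field_simp
    have h2 : (16 : ℝ) ^ α ≤ α * 32 ^ α := by
      calc (16 : ℝ) ^ α ≤ 32 ^ α := by gcongr; norm_num
        _ ≤ α * 32 ^ α := le_mul_of_one_le_left (by positivity) hα'
    rw [h1, mul_pow, hs]
    have h3 : t * (16 ^ α * lam ^ α) ≤ t * (α * 32 ^ α * lam ^ α) := by gcongr
    have h4 : 0 ≤ t * (α * 32 ^ α * lam ^ α) := by positivity
    linarith only [h3, h4]
  have hmean : ∀ (S : Ω → Fin n → Spin) (c : ℕ) (p : ℝ),
      |seedMean (fun ξ => psi α (ratio ν μ (S ξ))) c M ω - p| ≤ s * (16 * lam) ^ α →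
      |seedMean (fun ξ => psi α (Real.exp (logRatio ν μ (S ξ)) * θ)) c M ω - p| ≤ e := by
    intro S c p h
    have h1 := abs_seedMean_sub_le (fun ξ => hpt (S ξ)) c hMpos ω
    have h2 := abs_sub_le (seedMean (fun ξ => psi α (Real.exp (logRatio ν μ (S ξ)) * θ)) c M ω)
      (seedMean (fun ξ => psi α (ratio ν μ (S ξ))) c M ω) p
    linarith only [h, h1, h2, htot]
  have hα0 : 0 < moment ν μ α := moment_pos ν μ α
  simp only [estimate, ← hθdef]
  refine estimate_mem_of_abs_sub_le ν μ α hε hε1 (hmean _ _ _ m₄) (hmean _ _ _ m₅)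
    (hmom.trans ?_) (error_le hb hb1 hν hμ E hα hε (by rw [hN, Fintype.card_fin]) hN1)
  refine mul_le_mul_of_nonneg_right ?_ hα0.le
  rw [hδt]
  linarith only [hαt, hε]

end
end IsingDiv

open IsingDiv
theorem mainTheorem1 (α : ℕ) (hα : 1 ≤ α) (b : ℝ) (hb0 : 0 < b) (hb1 : b < 1) :
    ∃ (prog : Program α) (η C : ℝ), 0 < η ∧ 0 < C ∧
      ∀ (n m : ℕ) (G : SimpleGraph (Fin n)) (E : EdgeList G m) (ν μ : IsingModel G)
        (Ω : Type*) [MeasurableSpace Ω] (P : MeasureTheory.Measure Ω)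
        [MeasureTheory.IsProbabilityMeasure P] (O : Oracles α n Ω) (ε : ℝ),
        1 ≤ n →
        ν.MarginallyBounded b → μ.MarginallyBounded b →
        IsCostFunction n m O.sampleCost → IsCostFunction n m O.countCost →
        (∀ k : Fin (α + 1), IsSamplingOracle P (ν.interp μ k) (O.sample k)) →
        (∀ k : Fin (α + 1), IsCountingOracle P (ν.interp μ k) (O.count k)) →
        0 < ε → ε < 1 →
        ∃ A : Set (ℕ → Ω), MeasurableSet A ∧
          2 / 3 ≤ (MeasureTheory.Measure.infinitePi fun _ : ℕ => P).real A ∧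
          ∀ ω : ℕ → Ω, ∃ (s : State) (t : ℝ),
            Exec O ω prog (inputState E ν μ ε) s t ∧
            t ≤ C * (O.countCost (η * ε / ((n : ℝ) + m) ^ α) +
              ((n : ℝ) + m) ^ (2 * α) / ε ^ 2 *
                O.sampleCost (η * ε ^ 2 / ((n : ℝ) + m) ^ (2 * α))) ∧
            (ω ∈ A →
              Real.exp (-ε) * chiDivergence α ν.gibbs μ.gibbs ≤ s.output ∧
              s.output ≤ Real.exp ε * chiDivergence α ν.gibbs μ.gibbs) := by
  set K := IsingModel.scale α b with hK
  have hKpos : (0 : ℝ) < K := by exact_mod_cast IsingModel.scale_pos hα hb0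
  set K' := 20 * K ^ 2 with hK'
  set c₁ : ℝ := (countAcc α (2 * K)).cost + (sampleAcc α (2 * K)).cost + (rounds α K').cost +
    (outputExpr α).cost + 155 with hc₁
  set c₂ : ℝ := 3 * (K' + 1) * (111 + (psiExpr α).cost) with hc₂
  have hc₁pos : 0 < c₁ := by positivity
  have hc₂pos : 0 < c₂ := by positivity
  refine ⟨algorithm hα (2 * K) K', 1 / (2 * K), c₁ + c₂, by positivity, by positivity, ?_⟩
  intro n m G E ν μ Ω _ P _ O ε hn hν hμ hTs hTc hS hC hε hε1
  set N : ℝ := (n : ℝ) + m with hN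
  have hN1 : 1 ≤ N := by
    have h1 : (1 : ℝ) ≤ n := by exact_mod_cast hn
    have h2 : (0 : ℝ) ≤ m := m.cast_nonneg
    linarith
  have hN0 : 0 < N := by linarith
  obtain ⟨δ, hδ⟩ : ∃ δ, δ = 1 / (2 * (K : ℝ)) * ε / N ^ α := ⟨_, rfl⟩
  obtain ⟨δ', hδ'⟩ : ∃ δ', δ' = 1 / (2 * (K : ℝ)) * ε ^ 2 / N ^ (2 * α) := ⟨_, rfl⟩
  rw [← hδ, ← hδ']
  have hδpos : 0 < δ := by rw [hδ]; positivity
  have hδ'pos : 0 < δ' := by rw [hδ']; positivity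
  have hδ₁ : δ = ε / (2 * K * N ^ α) := by rw [hδ]; field_simp
  have hδ'₁ : δ' = ε ^ 2 / (2 * K * N ^ (2 * α)) := by rw [hδ']; field_simp
  set B : ℝ := K' * N ^ (2 * α) / ε ^ 2 with hB
  have hBM : 20 * (K : ℝ) ^ 2 * N ^ (2 * α) / ε ^ 2 ≤ (⌈B⌉₊ : ℝ) := by
    refine le_trans (le_of_eq ?_) (Nat.le_ceil B)
    rw [hB, hK']; push_cast; ring
  obtain ⟨A, hA, hAp, hAω⟩ := exists_event_estimate hα hb0 hb1 hn E hν hμ hS hC hε hε1 hδ₁ hδ'₁ hBM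
  refine ⟨A, hA, hAp, fun ω => ?_⟩
  have hrun : Halts O ω (algorithm hα (2 * K) K') (inputState E ν μ ε) _ _ :=
    Halts.seq ((halts_setupProgram (O := O) (ω := ω) (E := E) (ν := ν) (μ := μ) hα
      (K := 2 * K) (K' := K') hδpos (by rw [hδ₁]; push_cast; rfl) (by rw [hδ'₁]; push_cast; rfl)
      hB).mono le_rfl fun s hs => halts_passesProgram hα hδ'pos hs)
  obtain ⟨s, t, hex, ht, hout⟩ := hrun
  refine ⟨s, t, hex, ht.trans ?_, fun hω => hAω ω hω _ hout⟩
  -- every call costs at least `N`, and there are at least `N ^ (2 α) / ε ^ 2 ≥ 1` calls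
  have hTc' : N ≤ O.countCost δ := hTc.2 δ hδpos
  have hTs' : N ≤ O.sampleCost δ' := hTs.2 δ' hδ'pos
  set Tc := O.countCost δ
  set Ts := O.sampleCost δ'
  set r := N ^ (2 * α) / ε ^ 2 with hr
  have hr1 : 1 ≤ r := by
    rw [hr, one_le_div (by positivity)]
    exact (pow_le_one₀ hε.le hε1.le).trans (one_le_pow₀ hN1)
  have hM : (⌈B⌉₊ : ℝ) ≤ (K' + 1) * r := by
    have h1 : B = K' * r := by rw [hB, hr]; ring
    have h2 := (Nat.ceil_lt_add_one (by positivity : 0 ≤ B)).le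
    linarith
  have hψ : (0 : ℝ) ≤ (psiExpr α).cost := Nat.cast_nonneg _
  have h1 : Ts + 40 * N + 67 + (3 + (psiExpr α).cost) ≤ (111 + (psiExpr α).cost) * Ts := by
    nlinarith
  have h2 : 3 * (⌈B⌉₊ : ℝ) * (Ts + 40 * N + 67 + (3 + (psiExpr α).cost)) ≤ c₂ * (r * Ts) := by
    calc _ ≤ 3 * ((K' + 1) * r) * ((111 + (psiExpr α).cost) * Ts) := by gcongr; linarith
      _ = _ := by rw [hc₂]; ring
  have h3 : (countAcc α (2 * K)).cost + (sampleAcc α (2 * K)).cost + (rounds α K').cost + 42 +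
      3 * Tc + 40 * N + (70 + (outputExpr α).cost) ≤ c₁ * Tc := by
    have h4 : c₁ - 43 ≤ (c₁ - 43) * Tc :=
      le_mul_of_one_le_right (by
        have h6 : (0 : ℝ) ≤ (countAcc α (2 * K)).cost := Nat.cast_nonneg _
        have h7 : (0 : ℝ) ≤ (sampleAcc α (2 * K)).cost := Nat.cast_nonneg _
        have h8 : (0 : ℝ) ≤ (rounds α K').cost := Nat.cast_nonneg _
        have h9 : (0 : ℝ) ≤ (outputExpr α).cost := Nat.cast_nonneg _
        linarith) (by linarith)
    linarith
  have h5 : 0 ≤ c₁ * (r * Ts) := by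
    have : 0 ≤ Ts := by linarith
    positivity
  have h6 : 0 ≤ c₂ * Tc := mul_nonneg hc₂pos.le (by linarith)
  calc _ = ((countAcc α (2 * K)).cost + (sampleAcc α (2 * K)).cost + (rounds α K').cost + 42 +
      3 * Tc + 40 * N + (70 + (outputExpr α).cost)) +
      3 * (⌈B⌉₊ : ℝ) * (Ts + 40 * N + 67 + (3 + (psiExpr α).cost)) := by ring
    _ ≤ c₁ * Tc + c₂ * (r * Ts) := add_le_add h3 h2
    _ ≤ _ := by linarith
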